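/- Let $v_{4,0},v_{2,2},v_{0,4},v_{6,0},v_{4,2},v_{2,4},v_{0,6}$ be real, $A=\frac38(v_{4,0}+v_{0,4})$, $B=\frac34(v_{4,0}-v_{0,4})$, $C=\frac18v_{2,2}$. With $w=J_1J_2\cos(2\phi_1-2\phi_2)$, consider the normal form of the detuned 2:2 resonance, $K_0+K_2$ (order $N=1$) or $K_0+K_2+K_4$ (order $N=2$), where $K_0=J_1+J_2$, $$K_2=\delta J_1+\tfrac32v_{4,0}J_1^2+\tfrac32v_{0,4}J_2^2+\tfrac12v_{2,2}(2J_1J_2+w),$$ $$\begin{aligned}K_4={}&-\delta\left[3v_{4,0}J_1^2+\tfrac12v_{2,2}(2J_1J_2+w)\right]+\tfrac14(10v_{6,0}-17v_{4,0}^2)J_1^3+\tfrac14(10v_{0,6}-17v_{0,4}^2)J_2^3\\&+\tfrac14J_1\left[(6v_{4,2}-\tfrac94v_{2,2}^2-12v_{2,2}v_{4,0})J_1J_2+(4v_{4,2}-2v_{2,2}^2-5v_{2,2}v_{4,0})w\right]\\&+\tfrac14J_2\left[(6v_{2,4}-\tfrac94v_{2,2}^2-12v_{2,2}v_{0,4})J_1J_2+(4v_{2,4}-2v_{2,2}^2-5v_{2,2}v_{0,4})w\right].\end{aligned}$$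 Fixing $\mathcal E=J_1+J_2>0$ and putting $J=J_1$, $\psi=\phi_1-\phi_2$ gives a one-degree-of-freedom Hamiltonian system in $(J,\psi)$, $0<J<\mathcal E$, completed by the two normal modes $J_1=0$ and $J_2=0$, which are the origins of the planar charts $(\sqrt{2J}\cos\psi,\sqrt{2J}\sin\psi)$ and $(\sqrt{2(\mathcal E-J)}\cos\psi,\sqrt{2(\mathcal E-J)}\sin\psi)$. Fixed points with $\psi=0,\pi$ are called inclined, those with $\psi=\pm\pi/2$ loop. As $\mathcal E$ increases, a pitchfork at a normal mode is the appearance out of it of a pair of stable fixed points, the mode turning from stable to unstable; an anti-pitchfork is the absorption of such a pair by the mode, which turns from unstable to stable. (Stable: elliptic and Lyapunov stable; unstable: a hyperbolic saddle.) A global bifurcation at $\mathcal E_c$ means that both normal modes are saddles for $\mathcal E$ near $\mathcal E_c$, and are joined by heteroclinic orbits (in both directions) for $\mathcal E=\mathcal E_c$ but by none for nearby $\mathcal E\ne\mathcal E_c$. Put $$\mathcal E_{1I}=\frac{\delta}{2(2A-B-6C)}+\frac{(136A^2+34B^2+280BC+456C^2-8A(17B+70C)+15v_{2,4}-45v_{0,6})\delta^2}{48(2A-B-6C)^3},$$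 $$\mathcal E_{1L}=\frac{\delta}{2(2A-B-2C)}+\frac{(136A^2+34B^2+104BC+72C^2-8A(17B+26C)+3v_{2,4}-45v_{0,6})\delta^2}{48(2A-B-2C)^3},$$ $$\mathcal E_{2I}=-\frac{\delta}{2(2A+B-6C)}-\frac{(56A^2+14B^2+8A(7B-74C)-296BC+1272C^2+45v_{6,0}-15v_{4,2})\delta^2}{48(2A+B-6C)^3},$$ $$\mathcal E_{2L}=-\frac{\delta}{2(2A+B-2C)}-\frac{(56A^2+14B^2+8A(7B-22C)-88BC+120C^2+45v_{6,0}-3v_{4,2})\delta^2}{48(2A+B-2C)^3},$$ and $\mathcal E_{GB}=-\frac{\delta}{2B}$; let $\mathcal E^{(1)}_{1I}$, etc., denote the first order terms in $\delta$. Assume $A=2C>0$ (the degenerate case $\mu=0$) and $\delta<0$. (a) For the system of order $N=1$: i) if $B>-2C$, two pitchforks occur concurrently, of an inclined pair from $J_1=0$ and of a loop pair from $J_2=0$, at $\mathcal E=\mathcal E^{(1)}_{1I}=\mathcal E^{(1)}_{2L}$; ii) if $B>0$, a global bifurcation occurs at $\mathcal E=\mathcal E_{GB}$; iii) if $B>2C$,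 two anti-pitchforks occur concurrently, of the loop pair into $J_1=0$ and of the inclined pair into $J_2=0$, at $\mathcal E=\mathcal E^{(1)}_{1L}=\mathcal E^{(1)}_{2I}$. (b) For the system of order $N=2$ and $|\delta|$ sufficiently small, under the same respective conditions on $B$, the same bifurcations occur: the pitchforks at values $\mathcal E_{1I}+O(\delta^3)$ and $\mathcal E_{2L}+O(\delta^3)$, the global bifurcation at $\mathcal E_{GB}+O(\delta^2)$, and the anti-pitchforks at $\mathcal E_{1L}+O(\delta^3)$ and $\mathcal E_{2I}+O(\delta^3)$; the two pitchfork values coincide up to $O(\delta^2)$, and so do the two anti-pitchfork values. -/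

import Mathlib

open Set Filter Topology

namespace Resonance22

/-! ## The normal form of the 2:2 resonance -/

/-- The coefficients `v_{2k,2l}` of the monomials `x₁^{2k} x₂^{2l}` of degree four and six. -/
structure Coeffs where
  v40 : ℝ
  v22 : ℝ
  v04 : ℝ
  v60 : ℝ
  v42 : ℝ
  v24 : ℝ
  v06 : ℝ

namespace Coeffs

noncomputable def A (v : Coeffs) : ℝ := 3 / 8 * (v.v40 + v.v04)
noncomputable def B (v : Coeffs) : ℝ := 3 / 4 * (v.v40 - v.v04)
noncomputable def C (v : Coeffs) : ℝ := 1 / 8 * v.v22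

end Coeffs

/-- Second order term of the normal form, as a function of the actions `J₁, J₂` and of the
invariant `w = J₁ J₂ cos (2 φ₁ - 2 φ₂)`. -/
noncomputable def K2 (v : Coeffs) (δ J₁ J₂ w : ℝ) : ℝ :=
  δ * J₁ + 3 / 2 * v.v40 * J₁ ^ 2 + 3 / 2 * v.v04 * J₂ ^ 2 + 1 / 2 * v.v22 * (2 * (J₁ * J₂) + w)

/-- Fourth order term of the normal form, in the same variables. -/
noncomputable def K4 (v : Coeffs) (δ J₁ J₂ w : ℝ) : ℝ :=
  -δ * (3 * v.v40 * J₁ ^ 2 + 1 / 2 * v.v22 * (2 * (J₁ * J₂) + w))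
  + 1 / 4 * (10 * v.v60 - 17 * v.v40 ^ 2) * J₁ ^ 3
  + 1 / 4 * (10 * v.v06 - 17 * v.v04 ^ 2) * J₂ ^ 3
  + 1 / 4 * J₁ * ((6 * v.v42 - 9 / 4 * v.v22 ^ 2 - 12 * v.v22 * v.v40) * (J₁ * J₂)
      + (4 * v.v42 - 2 * v.v22 ^ 2 - 5 * v.v22 * v.v40) * w)
  + 1 / 4 * J₂ * ((6 * v.v24 - 9 / 4 * v.v22 ^ 2 - 12 * v.v22 * v.v04) * (J₁ * J₂)
      + (4 * v.v24 - 2 * v.v22 ^ 2 - 5 * v.v22 * v.v04) * w)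

/-- The normal form truncated at order `N = 1`. -/
noncomputable def normalForm₁ (v : Coeffs) (δ J₁ J₂ w : ℝ) : ℝ :=
  J₁ + J₂ + K2 v δ J₁ J₂ w

/-- The normal form truncated at order `N = 2`. -/
noncomputable def normalForm₂ (v : Coeffs) (δ J₁ J₂ w : ℝ) : ℝ :=
  J₁ + J₂ + K2 v δ J₁ J₂ w + K4 v δ J₁ J₂ w

/-! ## The reduced one degree of freedom system

Below `K` is a normal form, as a function of `(J₁, J₂, w)`; `E = J₁ + J₂` is the distinguished
parameter, `J = J₁` and `ψ = φ₁ - φ₂`. -/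

/-- The reduced Hamiltonian in the variables `(J, ψ)`, `0 < J < E`. -/
noncomputable def reduced (K : ℝ → ℝ → ℝ → ℝ) (E J ψ : ℝ) : ℝ :=
  K J (E - J) (J * (E - J) * Real.cos (2 * ψ))

/-- The planar Hamiltonian in `x = √(2J) cos ψ`, `y = √(2J) sin ψ`: the origin is the normal
mode `J₁ = 0`, and `x² + y² = 2E` is the singular circle. -/
noncomputable def chart₁ (K : ℝ → ℝ → ℝ → ℝ) (E x y : ℝ) : ℝ :=
  K ((x ^ 2 + y ^ 2) / 2) (E - (x ^ 2 + y ^ 2) / 2)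
    ((x ^ 2 - y ^ 2) / 2 * (E - (x ^ 2 + y ^ 2) / 2))

/-- The planar Hamiltonian in `x = √(2(E - J)) cos ψ`, `y = √(2(E - J)) sin ψ`: the origin is
the normal mode `J₂ = 0`. -/
noncomputable def chart₂ (K : ℝ → ℝ → ℝ → ℝ) (E x y : ℝ) : ℝ :=
  K (E - (x ^ 2 + y ^ 2) / 2) ((x ^ 2 + y ^ 2) / 2)
    ((x ^ 2 - y ^ 2) / 2 * (E - (x ^ 2 + y ^ 2) / 2))

theorem chart₁_eq_reduced (K : ℝ → ℝ → ℝ → ℝ) (E J ψ : ℝ) (hJ : 0 ≤ J) :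
    chart₁ K E (√(2 * J) * Real.cos ψ) (√(2 * J) * Real.sin ψ) = reduced K E J ψ := by
  have h : √(2 * J) ^ 2 = 2 * J := Real.sq_sqrt (by linarith)
  have h1 : ((√(2 * J) * Real.cos ψ) ^ 2 + (√(2 * J) * Real.sin ψ) ^ 2) / 2 = J := by
    rw [mul_pow, mul_pow, h, ← mul_add, Real.cos_sq_add_sin_sq]; ring
  have h2 : ((√(2 * J) * Real.cos ψ) ^ 2 - (√(2 * J) * Real.sin ψ) ^ 2) / 2
      = J * Real.cos (2 * ψ) := by
    rw [mul_pow, mul_pow, h, Real.cos_two_mul, Real.sin_sq]; ring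
  unfold chart₁ reduced
  rw [h1, h2]
  congr 1
  ring

theorem chart₂_eq_reduced (K : ℝ → ℝ → ℝ → ℝ) (E J ψ : ℝ) (hJ : J ≤ E) :
    chart₂ K E (√(2 * (E - J)) * Real.cos ψ) (√(2 * (E - J)) * Real.sin ψ)
      = reduced K E J ψ := by
  have h : √(2 * (E - J)) ^ 2 = 2 * (E - J) := Real.sq_sqrt (by linarith)
  have h1 : ((√(2 * (E - J)) * Real.cos ψ) ^ 2 + (√(2 * (E - J)) * Real.sin ψ) ^ 2) / 2
      = E - J := by
    rw [mul_pow, mul_pow, h, ← mul_add, Real.cos_sq_add_sin_sq]; ring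
  have h2 : ((√(2 * (E - J)) * Real.cos ψ) ^ 2 - (√(2 * (E - J)) * Real.sin ψ) ^ 2) / 2
      = (E - J) * Real.cos (2 * ψ) := by
    rw [mul_pow, mul_pow, h, Real.cos_two_mul, Real.sin_sq]; ring
  unfold chart₂ reduced
  rw [h1, h2, sub_sub_cancel]
  congr 1
  ring

/-- The reduced Hamiltonian at order `N = 1`, as `ℰ + 𝒜₁ + ℬ₁ cos 2ψ`. -/
theorem reduced_normalForm₁ (v : Coeffs) (δ E J ψ : ℝ) :
    reduced (normalForm₁ v δ) E J ψ = E
      + ((2 * v.A - v.B) * E ^ 2 + (-4 * v.A + 2 * v.B + 8 * v.C) * E * J + δ * J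
        + 4 * (v.A - 2 * v.C) * J ^ 2)
      + 4 * v.C * J * (E - J) * Real.cos (2 * ψ) := by
  unfold reduced normalForm₁ K2 Coeffs.A Coeffs.B Coeffs.C
  ring

/-! ## Equilibria and their stability for a planar Hamiltonian -/

/-- `(x, y)` is a fixed point (critical point) of the Hamiltonian `h`. -/
def IsEquilibrium (h : ℝ → ℝ → ℝ) (x y : ℝ) : Prop :=
  HasDerivAt (fun s => h s y) 0 x ∧ HasDerivAt (fun s => h x s) 0 y

/-- The determinant of the Hessian of `h`, which is also that of the (traceless) linearization
of the Hamiltonian vector field: at a fixed point the eigenvalues are `±√(-hessDet)`. -/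
noncomputable def hessDet (h : ℝ → ℝ → ℝ) (x y : ℝ) : ℝ :=
  deriv (fun s => deriv (fun t => h t y) s) x * deriv (fun s => deriv (fun t => h x t) s) y
    - deriv (fun s => deriv (fun t => h t s) x) y ^ 2

/-- `(p, q)` solves Hamilton's equations `x' = ∂h/∂y`, `y' = -∂h/∂x` on the time set `I`. -/
def SolvesOn (h : ℝ → ℝ → ℝ) (p q : ℝ → ℝ) (I : Set ℝ) : Prop :=
  ∀ t ∈ I, HasDerivWithinAt p (deriv (fun s => h (p t) s) (q t)) I t ∧
    HasDerivWithinAt q (-deriv (fun s => h s (q t)) (p t)) I t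

/-- Lyapunov stability for the flow of Hamilton's equations. -/
def LyapunovStable (h : ℝ → ℝ → ℝ) (x y : ℝ) : Prop :=
  ∀ ε > 0, ∃ ρ > 0, ∀ (T : ℝ) (p q : ℝ → ℝ), 0 < T → SolvesOn h p q (Icc 0 T) →
    (p 0 - x) ^ 2 + (q 0 - y) ^ 2 < ρ ^ 2 →
    ∀ t ∈ Icc 0 T, (p t - x) ^ 2 + (q t - y) ^ 2 < ε ^ 2

/-- A stable fixed point: elliptic and Lyapunov stable. -/
def IsStablePoint (h : ℝ → ℝ → ℝ) (x y : ℝ) : Prop :=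
  IsEquilibrium h x y ∧ 0 < hessDet h x y ∧ LyapunovStable h x y

/-- An unstable fixed point: a hyperbolic saddle. -/
def IsUnstablePoint (h : ℝ → ℝ → ℝ) (x y : ℝ) : Prop :=
  IsEquilibrium h x y ∧ hessDet h x y < 0

/-! ## Pitchfork and anti-pitchfork bifurcations at a normal mode -/

/-- The origin is stable and is the only fixed point in the disc of radius `r`. -/
def OnlyOrigin (h : ℝ → ℝ → ℝ) (r : ℝ) : Prop :=
  IsStablePoint h 0 0 ∧
    ∀ x y, x ^ 2 + y ^ 2 < r ^ 2 → IsEquilibrium h x y → x = 0 ∧ y = 0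

/-- The origin is unstable, and besides it the fixed points in the disc of radius `r` are exactly
the pair of stable points `±(a, b)`. -/
def OriginAndPair (h : ℝ → ℝ → ℝ) (r a b : ℝ) : Prop :=
  IsUnstablePoint h 0 0 ∧ 0 < a ^ 2 + b ^ 2 ∧ a ^ 2 + b ^ 2 < r ^ 2 ∧
    IsStablePoint h a b ∧ IsStablePoint h (-a) (-b) ∧
    ∀ x y, x ^ 2 + y ^ 2 < r ^ 2 → IsEquilibrium h x y →
      (x = 0 ∧ y = 0) ∨ (x = a ∧ y = b) ∨ (x = -a ∧ y = -b)

/-- For the family `h E`, as `E` increases through `Ec > 0` a pair of stable fixed points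
`±s(E)(a, b)` branches off the origin, which loses its stability. The disc of radius `r` lies
inside the singular circle `x² + y² = 2E`. -/
def PitchforkAt (h : ℝ → ℝ → ℝ → ℝ) (a b Ec : ℝ) : Prop :=
  ∃ η > 0, ∃ r > 0, r ^ 2 < 2 * (Ec - η) ∧ ∃ s : ℝ → ℝ,
    (∀ E ∈ Ioo (Ec - η) Ec, OnlyOrigin (h E) r) ∧
    (∀ E ∈ Ioo Ec (Ec + η), OriginAndPair (h E) r (s E * a) (s E * b)) ∧
    Tendsto s (𝓝[>] Ec) (𝓝 0)

/-- For the family `h E`, as `E` increases through `Ec > 0` a pair of stable fixed points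
`±s(E)(a, b)` is absorbed by the origin, which becomes stable. -/
def AntiPitchforkAt (h : ℝ → ℝ → ℝ → ℝ) (a b Ec : ℝ) : Prop :=
  ∃ η > 0, ∃ r > 0, r ^ 2 < 2 * (Ec - η) ∧ ∃ s : ℝ → ℝ,
    (∀ E ∈ Ioo (Ec - η) Ec, OriginAndPair (h E) r (s E * a) (s E * b)) ∧
    (∀ E ∈ Ioo Ec (Ec + η), OnlyOrigin (h E) r) ∧
    Tendsto s (𝓝[<] Ec) (𝓝 0)

/-- Pitchfork of a pair of inclined orbits (`ψ = 0, π`) from the normal mode `J₁ = 0`. -/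
def Pitchfork1I (K : ℝ → ℝ → ℝ → ℝ) (Ec : ℝ) : Prop := PitchforkAt (chart₁ K) 1 0 Ec

/-- Pitchfork of a pair of loop orbits (`ψ = ±π/2`) from the normal mode `J₂ = 0`. -/
def Pitchfork2L (K : ℝ → ℝ → ℝ → ℝ) (Ec : ℝ) : Prop := PitchforkAt (chart₂ K) 0 1 Ec

/-- Anti-pitchfork of a pair of loop orbits into the normal mode `J₁ = 0`. -/
def AntiPitchfork1L (K : ℝ → ℝ → ℝ → ℝ) (Ec : ℝ) : Prop := AntiPitchforkAt (chart₁ K) 0 1 Ec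

/-- Anti-pitchfork of a pair of inclined orbits into the normal mode `J₂ = 0`. -/
def AntiPitchfork2I (K : ℝ → ℝ → ℝ → ℝ) (Ec : ℝ) : Prop := AntiPitchforkAt (chart₂ K) 1 0 Ec

/-! ## Global bifurcation -/

/-- `(J, ψ)` is an orbit of the reduced system which lies off both normal modes and for which `J`
tends to `a` in the past and to `b` in the future. -/
def IsConnection (K : ℝ → ℝ → ℝ → ℝ) (E a b : ℝ) (J ψ : ℝ → ℝ) : Prop :=
  (∀ t, 0 < J t ∧ J t < E) ∧ SolvesOn (reduced K E) J ψ univ ∧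
    Tendsto J atBot (𝓝 a) ∧ Tendsto J atTop (𝓝 b)

/-- Global bifurcation at `Ec > 0`: near `Ec` the normal modes `J = 0` and `J = E` are both
saddles; they are joined by heteroclinic orbits, in both directions, when `E = Ec`, and by none
when `E` is close to but different from `Ec`. -/
def GlobalBifurcationAt (K : ℝ → ℝ → ℝ → ℝ) (Ec : ℝ) : Prop :=
  ∃ η > 0, η < Ec ∧
    (∀ E ∈ Ioo (Ec - η) (Ec + η),
      IsUnstablePoint (chart₁ K E) 0 0 ∧ IsUnstablePoint (chart₂ K E) 0 0) ∧
    (∃ J ψ, IsConnection K Ec 0 Ec J ψ) ∧ (∃ J ψ, IsConnection K Ec Ec 0 J ψ) ∧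
    ∀ E ∈ Ioo (Ec - η) (Ec + η), E ≠ Ec →
      (¬ ∃ J ψ, IsConnection K E 0 E J ψ) ∧ ¬ ∃ J ψ, IsConnection K E E 0 J ψ

/-! ## The bifurcation curves: first and second order in the detuning -/

noncomputable def E1I₁ (v : Coeffs) (δ : ℝ) : ℝ := δ / (2 * (2 * v.A - v.B - 6 * v.C))
noncomputable def E1L₁ (v : Coeffs) (δ : ℝ) : ℝ := δ / (2 * (2 * v.A - v.B - 2 * v.C))
noncomputable def E2I₁ (v : Coeffs) (δ : ℝ) : ℝ := -δ / (2 * (2 * v.A + v.B - 6 * v.C))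
noncomputable def E2L₁ (v : Coeffs) (δ : ℝ) : ℝ := -δ / (2 * (2 * v.A + v.B - 2 * v.C))
noncomputable def EGB₁ (v : Coeffs) (δ : ℝ) : ℝ := -δ / (2 * v.B)

noncomputable def E1I₂ (v : Coeffs) (δ : ℝ) : ℝ := E1I₁ v δ +
  (136 * v.A ^ 2 + 34 * v.B ^ 2 + 280 * v.B * v.C + 456 * v.C ^ 2
    - 8 * v.A * (17 * v.B + 70 * v.C) + 15 * v.v24 - 45 * v.v06) * δ ^ 2
  / (48 * (2 * v.A - v.B - 6 * v.C) ^ 3)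

noncomputable def E1L₂ (v : Coeffs) (δ : ℝ) : ℝ := E1L₁ v δ +
  (136 * v.A ^ 2 + 34 * v.B ^ 2 + 104 * v.B * v.C + 72 * v.C ^ 2
    - 8 * v.A * (17 * v.B + 26 * v.C) + 3 * v.v24 - 45 * v.v06) * δ ^ 2
  / (48 * (2 * v.A - v.B - 2 * v.C) ^ 3)

noncomputable def E2I₂ (v : Coeffs) (δ : ℝ) : ℝ := E2I₁ v δ -
  (56 * v.A ^ 2 + 14 * v.B ^ 2 + 8 * v.A * (7 * v.B - 74 * v.C) - 296 * v.B * v.C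
    + 1272 * v.C ^ 2 + 45 * v.v60 - 15 * v.v42) * δ ^ 2
  / (48 * (2 * v.A + v.B - 6 * v.C) ^ 3)

noncomputable def E2L₂ (v : Coeffs) (δ : ℝ) : ℝ := E2L₁ v δ -
  (56 * v.A ^ 2 + 14 * v.B ^ 2 + 8 * v.A * (7 * v.B - 22 * v.C) - 88 * v.B * v.C
    + 120 * v.C ^ 2 + 45 * v.v60 - 3 * v.v42) * δ ^ 2
  / (48 * (2 * v.A + v.B - 2 * v.C) ^ 3)

end Resonance22

open Resonance22

/-!
Since the planar Hamiltonians at the two normal modes are even in `x` and in `y`, they are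
polynomials in `r = x² / 2` and `z = y² / 2` (`EvenHam`), and a fixed point is a solution of
`x ∂h/∂r = 0 = y ∂h/∂z`. Near a mode of which one eigenvalue `a` of the Hessian passes through
zero, the other one, `b`, keeps its sign; this confines the fixed points to an axis, say `z = 0`, on which
`h = c + a r + q r² + …`. If `q` has the sign of `b`, a critical point `r ≈ -a / (2 q) > 0` exists
exactly where `a` and `b` have opposite signs, and whichever of the origin and the pair is not a
saddle is a strict extremum of `h` (`EvenHam.Controlled`). Strict extrema are Lyapunov stable by
conservation of energy (`IsStrictExtremum.lyapunovStable`). So a simple zero of `a`, as a function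
of `E`, is a pitchfork or an anti-pitchfork (`EvenHam.ContinuousFamily.pitchforkAt`,
`EvenHam.ContinuousFamily.antiPitchforkAt`).

When `A = 2 C`, the reduced Hamiltonian is
`c + D J + J (E - J) ((f0 + f1 J) + (g0 + g1 J) cos 2ψ)` (`reduced_nf`), where `f` vanishes at order
one and is small with `δ` and `E` at order two, while `g` is close to `4 C`. The modes have energies
`c` and `c + D E`, so that a heteroclinic orbit requires `D = 0` (`energy_eq_of_connection`).
Conversely, if `D = 0` then the level set through the modes contains the curves
`cos 2ψ = -f(J) / g(J)`; on them the motion is a scalar autonomous equation, which is solved by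
quadrature (`exists_connection`).

All five bifurcation values are thus roots of equations `δ + s E + p δ E + κ E² = 0`, where `s` is
`2B`, `2B + 4C` or `2B - 4C`. Both pitchforks have `s = 2B + 4C` and both anti-pitchforks have
`s = 2B - 4C`, hence the coincidences. At order one `p = κ = 0`; at order two `exists_root` gives
the root `-δ / s + (p / s² - κ / s³) δ² + O(δ³)`, and the sign conditions hold for small `δ` by
continuity.
-/

namespace Resonance22

/-! ### Conservation of energy and Lyapunov stability of strict extrema -/

theorem SolvesOn.energy_hasDerivWithinAt {h : ℝ → ℝ → ℝ} {p q : ℝ → ℝ} {I : Set ℝ}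
    (hd : Differentiable ℝ fun z : ℝ × ℝ => h z.1 z.2) (hs : SolvesOn h p q I) {t : ℝ}
    (ht : t ∈ I) : HasDerivWithinAt (fun t => h (p t) (q t)) 0 I t := by
  obtain ⟨hp, hq⟩ := hs t ht
  have hF := (hd (p t, q t)).hasFDerivAt
  set L := fderiv ℝ (fun z : ℝ × ℝ => h z.1 z.2) (p t, q t) with hL
  have h1 : HasDerivAt (fun s => h s (q t)) (L (1, 0)) (p t) :=
    HasFDerivAt.comp_hasDerivAt (f := fun s : ℝ => (s, q t)) (p t) hF
      ((hasDerivAt_id (p t)).prodMk (hasDerivAt_const (p t) (q t)))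
  have h2 : HasDerivAt (fun s => h (p t) s) (L (0, 1)) (q t) :=
    HasFDerivAt.comp_hasDerivAt (f := fun s : ℝ => (p t, s)) (q t) hF
      ((hasDerivAt_const (q t) (p t)).prodMk (hasDerivAt_id (q t)))
  have h3 := HasFDerivAt.comp_hasDerivWithinAt (f := fun t => (p t, q t)) t hF (hp.prodMk hq)
  rw [h1.deriv, h2.deriv] at h3
  have : ((L (0, 1), -L (1, 0)) : ℝ × ℝ)
      = L (0, 1) • ((1, 0) : ℝ × ℝ) + (-L (1, 0)) • ((0, 1) : ℝ × ℝ) := by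
    ext <;> simp
  have h0 : L (L (0, 1), -L (1, 0)) = 0 := by
    rw [this, map_add, map_smul, map_smul, smul_eq_mul, smul_eq_mul]
    ring
  rw [h0] at h3
  exact h3

theorem SolvesOn.energy_Icc {h : ℝ → ℝ → ℝ} {p q : ℝ → ℝ} {T : ℝ}
    (hd : Differentiable ℝ fun z : ℝ × ℝ => h z.1 z.2) (hs : SolvesOn h p q (Icc 0 T)) {t : ℝ}
    (ht : t ∈ Icc 0 T) : h (p t) (q t) = h (p 0) (q 0) := by
  refine constant_of_derivWithin_zero (f := fun t => h (p t) (q t)) (a := 0) (b := T)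
    (fun s hs' => (hs.energy_hasDerivWithinAt hd hs').differentiableWithinAt) ?_ t ht
  intro s hs'
  have hT : 0 < T := hs'.1.trans_lt hs'.2
  exact (hs.energy_hasDerivWithinAt hd (Ico_subset_Icc_self hs')).derivWithin
    (uniqueDiffOn_Icc hT s (Ico_subset_Icc_self hs'))

theorem SolvesOn.energy_univ {h : ℝ → ℝ → ℝ} {p q : ℝ → ℝ}
    (hd : Differentiable ℝ fun z : ℝ × ℝ => h z.1 z.2) (hs : SolvesOn h p q univ) (t t' : ℝ) :
    h (p t) (q t) = h (p t') (q t') := by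
  have key : ∀ s, HasDerivAt (fun t => h (p t) (q t)) 0 s := fun s =>
    (hs.energy_hasDerivWithinAt hd (mem_univ s)).hasDerivAt univ_mem
  exact is_const_of_deriv_eq_zero (fun s => (key s).differentiableAt) (fun s => (key s).deriv) t t'

/-- `(x, y)` is a strict local extremum of `h`: the sign of `σ` tells minima from maxima. -/
def IsStrictExtremum (h : ℝ → ℝ → ℝ) (x y : ℝ) : Prop :=
  ∃ σ : ℝ, ∃ ε > 0, ∀ x' y', 0 < (x' - x) ^ 2 + (y' - y) ^ 2 →
    (x' - x) ^ 2 + (y' - y) ^ 2 ≤ ε ^ 2 → 0 < σ * (h x' y' - h x y)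

/-- A trajectory starting below the minimum of the energy on a small circle cannot cross it. -/
theorem IsStrictExtremum.lyapunovStable {h : ℝ → ℝ → ℝ} {x y : ℝ}
    (hd : Differentiable ℝ fun z : ℝ × ℝ => h z.1 z.2) (hx : IsStrictExtremum h x y) :
    LyapunovStable h x y := by
  obtain ⟨σ, ε₀, hε₀, hσ⟩ := hx
  intro ε hε
  set ε₁ := min ε ε₀ with hε₁
  have hε₁0 : 0 < ε₁ := lt_min hε hε₀
  have hcont : Continuous fun z : ℝ × ℝ => σ * (h z.1 z.2 - h x y) :=
    continuous_const.mul (hd.continuous.sub continuous_const)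
  set S : Set (ℝ × ℝ) := {z | (z.1 - x) ^ 2 + (z.2 - y) ^ 2 = ε₁ ^ 2} with hS
  have hSc : IsCompact S := by
    refine (isCompact_Icc (a := x - ε₁) (b := x + ε₁)).prod
      (isCompact_Icc (a := y - ε₁) (b := y + ε₁)) |>.of_isClosed_subset
      (isClosed_eq (by fun_prop) (by fun_prop)) ?_
    rintro ⟨a, b⟩ hab
    simp only [hS, mem_ofPred_eq] at hab
    have ha := abs_le_of_sq_le_sq' (a := a - x) (b := ε₁)
      (by nlinarith [sq_nonneg (b - y)]) hε₁0.le
    have hb := abs_le_of_sq_le_sq' (a := b - y) (b := ε₁)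
      (by nlinarith [sq_nonneg (a - x)]) hε₁0.le
    simp only [mem_prod, mem_Icc]
    exact ⟨⟨by linarith [ha.1], by linarith [ha.2]⟩, ⟨by linarith [hb.1], by linarith [hb.2]⟩⟩
  have hSne : S.Nonempty := ⟨(x + ε₁, y), by simp [hS]⟩
  obtain ⟨z₀, hz₀, hmin⟩ := hSc.exists_isMinOn hSne hcont.continuousOn
  set m := σ * (h z₀.1 z₀.2 - h x y) with hm
  have hm0 : 0 < m := by
    refine hσ _ _ ?_ ?_
    · rw [show (z₀.1 - x) ^ 2 + (z₀.2 - y) ^ 2 = ε₁ ^ 2 from hz₀]; positivity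
    · rw [show (z₀.1 - x) ^ 2 + (z₀.2 - y) ^ 2 = ε₁ ^ 2 from hz₀]
      exact pow_le_pow_left₀ hε₁0.le (min_le_right _ _) 2
  have hev : ∀ᶠ z : ℝ × ℝ in 𝓝 (x, y), σ * (h z.1 z.2 - h x y) < m := by
    refine hcont.continuousAt.eventually_lt continuousAt_const ?_
    simpa using hm0
  obtain ⟨ρ₀, hρ₀, hball⟩ := Metric.eventually_nhds_iff.1 hev
  refine ⟨min ρ₀ ε₁, lt_min hρ₀ hε₁0, ?_⟩
  intro T p q hT hs h0 t ht
  have hlow : σ * (h (p 0) (q 0) - h x y) < m := by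
    refine hball (y := (p 0, q 0)) ?_
    have hle : (min ρ₀ ε₁) ^ 2 ≤ ρ₀ ^ 2 :=
      pow_le_pow_left₀ (lt_min hρ₀ hε₁0).le (min_le_left _ _) 2
    rw [Prod.dist_eq, max_lt_iff, Real.dist_eq, Real.dist_eq]
    exact ⟨abs_lt_of_sq_lt_sq (by nlinarith [sq_nonneg (q 0 - y)]) hρ₀.le,
      abs_lt_of_sq_lt_sq (by nlinarith [sq_nonneg (p 0 - x)]) hρ₀.le⟩
  have hdist0 : (p 0 - x) ^ 2 + (q 0 - y) ^ 2 < ε₁ ^ 2 :=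
    h0.trans_le (pow_le_pow_left₀ (lt_min hρ₀ hε₁0).le (min_le_right _ _) 2)
  suffices hlt : (p t - x) ^ 2 + (q t - y) ^ 2 < ε₁ ^ 2 from
    hlt.trans_le (pow_le_pow_left₀ hε₁0.le (min_le_left _ _) 2)
  by_contra! hge
  have hpc : ContinuousOn p (Icc 0 T) := fun s hs' => (hs s hs').1.continuousWithinAt
  have hqc : ContinuousOn q (Icc 0 T) := fun s hs' => (hs s hs').2.continuousWithinAt
  have hc : ContinuousOn (fun t => (p t - x) ^ 2 + (q t - y) ^ 2) (Icc 0 t) :=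
    (((hpc.sub continuousOn_const).pow 2).add ((hqc.sub continuousOn_const).pow 2)).mono
      (Icc_subset_Icc_right ht.2)
  obtain ⟨t', ht', heq⟩ := intermediate_value_Icc ht.1 hc ⟨hdist0.le, hge⟩
  have hen := hs.energy_Icc hd (t := t') ⟨ht'.1, ht'.2.trans ht.2⟩
  have hge' : m ≤ σ * (h (p t') (q t') - h x y) :=
    isMinOn_iff.1 hmin (p t', q t') heq
  rw [hen] at hge'
  linarith

/-! ### Even planar polynomials -/

/-- Coefficients of a planar Hamiltonian of degree six that is even in `x` and in `y`,
`c + F₁ρ + F₂ρ² + F₃ρ³ + d (G₀ + G₁ρ + G₂ρ²)` with `ρ = (x² + y²) / 2` and `d = (x² - y²) / 2`. -/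
structure EvenHam where
  c : ℝ
  F1 : ℝ
  F2 : ℝ
  F3 : ℝ
  G0 : ℝ
  G1 : ℝ
  G2 : ℝ

namespace EvenHam

/-- The polynomial as a function of `r = x² / 2` and `z = y² / 2`. -/
def poly (k : EvenHam) (r z : ℝ) : ℝ :=
  k.c + k.F1 * (r + z) + k.F2 * (r + z) ^ 2 + k.F3 * (r + z) ^ 3
    + (r - z) * (k.G0 + k.G1 * (r + z) + k.G2 * (r + z) ^ 2)

/-- The planar Hamiltonian with coefficients `k`. -/
noncomputable def eval (k : EvenHam) (x y : ℝ) : ℝ := k.poly (x ^ 2 / 2) (y ^ 2 / 2)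

/-- Exchanging `x` and `y` changes the sign of `d`. -/
def swap (k : EvenHam) : EvenHam := ⟨k.c, k.F1, k.F2, k.F3, -k.G0, -k.G1, -k.G2⟩

/-- `∂/∂r` of `poly`. -/
def polyR (k : EvenHam) (r z : ℝ) : ℝ :=
  k.F1 + k.G0 + 2 * k.F2 * (r + z) + 2 * k.G1 * r + 3 * k.F3 * (r + z) ^ 2
    + k.G2 * (3 * r ^ 2 + 2 * r * z - z ^ 2)

/-- `∂/∂z` of `poly`. -/
def polyZ (k : EvenHam) (r z : ℝ) : ℝ :=
  k.F1 - k.G0 + 2 * k.F2 * (r + z) - 2 * k.G1 * z + 3 * k.F3 * (r + z) ^ 2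
    + k.G2 * (r ^ 2 - 2 * r * z - 3 * z ^ 2)

/-- The difference quotient of `poly` in `z` between `0` and `z`. -/
def quotZ (k : EvenHam) (r z : ℝ) : ℝ :=
  k.F1 - k.G0 + k.F2 * (2 * r + z) - k.G1 * z + k.F3 * (3 * r ^ 2 + 3 * r * z + z ^ 2)
    + k.G2 * (r ^ 2 - r * z - z ^ 2)

theorem swap_eval (k : EvenHam) (x y : ℝ) : k.swap.eval x y = k.eval y x := by
  simp only [eval, poly, swap]; ring

theorem swap_polyR (k : EvenHam) (r z : ℝ) : k.swap.polyR r z = k.polyZ z r := by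
  simp only [polyR, polyZ, swap]; ring

theorem swap_polyZ (k : EvenHam) (r z : ℝ) : k.swap.polyZ r z = k.polyR z r := by
  simp only [polyR, polyZ, swap]; ring

theorem differentiable_eval (k : EvenHam) :
    Differentiable ℝ fun z : ℝ × ℝ => k.eval z.1 z.2 := by
  simp only [eval, poly]
  fun_prop

theorem hasDerivAt_poly_left (k : EvenHam) (r z : ℝ) :
    HasDerivAt (fun r => k.poly r z) (k.polyR r z) r := by
  have h1 : HasDerivAt (fun r : ℝ => r + z) 1 r := (hasDerivAt_id r).add_const z
  have h2 : HasDerivAt (fun r : ℝ => r - z) 1 r := (hasDerivAt_id r).sub_const z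
  have := ((((h1.const_mul k.F1).const_add k.c).add ((h1.pow 2).const_mul k.F2)).add
    ((h1.pow 3).const_mul k.F3)).add (h2.mul (((h1.const_mul k.G1).const_add k.G0).add
      ((h1.pow 2).const_mul k.G2)))
  refine (this.congr_deriv ?_).congr_of_eventuallyEq (Eventually.of_forall fun r => ?_)
  · simp only [polyR, Pi.add_apply, Pi.pow_apply]; push_cast; ring
  · simp only [poly, Pi.add_apply, Pi.mul_apply, Pi.pow_apply]

theorem hasDerivAt_left (k : EvenHam) (x y : ℝ) :
    HasDerivAt (fun s => k.eval s y) (x * k.polyR (x ^ 2 / 2) (y ^ 2 / 2)) x := by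
  have h := (k.hasDerivAt_poly_left (x ^ 2 / 2) (y ^ 2 / 2)).comp x
    (((hasDerivAt_id x).pow 2).div_const 2)
  refine (h.congr_deriv ?_).congr_of_eventuallyEq (Eventually.of_forall fun s => rfl)
  simp only [id]; push_cast; ring

theorem hasDerivAt_right (k : EvenHam) (x y : ℝ) :
    HasDerivAt (fun s => k.eval x s) (y * k.polyZ (x ^ 2 / 2) (y ^ 2 / 2)) y := by
  have h := k.swap.hasDerivAt_left y x
  simp only [swap_eval, swap_polyR] at h
  exact h

theorem isEquilibrium_iff (k : EvenHam) (x y : ℝ) :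
    IsEquilibrium k.eval x y ↔
      x * k.polyR (x ^ 2 / 2) (y ^ 2 / 2) = 0 ∧ y * k.polyZ (x ^ 2 / 2) (y ^ 2 / 2) = 0 := by
  constructor
  · rintro ⟨h1, h2⟩
    exact ⟨(k.hasDerivAt_left x y).unique h1, (k.hasDerivAt_right x y).unique h2⟩
  · rintro ⟨h1, h2⟩
    have h3 := k.hasDerivAt_left x y
    have h4 := k.hasDerivAt_right x y
    rw [h1] at h3; rw [h2] at h4
    exact ⟨h3, h4⟩

theorem hasDerivAt_mixed (k : EvenHam) (x : ℝ) :
    HasDerivAt (fun s => x * k.polyR (x ^ 2 / 2) (s ^ 2 / 2)) 0 0 := by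
  have hd : DifferentiableAt ℝ (fun z => k.polyR (x ^ 2 / 2) z) ((0 : ℝ) ^ 2 / 2) := by
    unfold polyR; fun_prop
  have hsq : HasDerivAt (fun s : ℝ => s ^ 2 / 2) 0 0 :=
    (((hasDerivAt_id (0 : ℝ)).pow 2).div_const 2).congr_deriv (by simp)
  have h := (HasDerivAt.comp (0 : ℝ) hd.hasDerivAt hsq).const_mul x
  rw [mul_zero, mul_zero] at h
  exact h

theorem hessDet_axis (k : EvenHam) (x : ℝ) :
    hessDet k.eval x 0 = (k.polyR (x ^ 2 / 2) 0
        + x ^ 2 * (2 * (k.F2 + k.G1) + 3 * (k.F3 + k.G2) * x ^ 2)) * k.polyZ (x ^ 2 / 2) 0 := by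
  have e1 : (fun s => deriv (fun t => k.eval t 0) s) = fun s => s * k.polyR (s ^ 2 / 2) 0 := by
    funext s
    rw [(k.hasDerivAt_left s 0).deriv]; norm_num
  have e2 : (fun s => deriv (fun t => k.eval x t) s)
      = fun s => s * k.polyZ (x ^ 2 / 2) (s ^ 2 / 2) := by
    funext s
    rw [(k.hasDerivAt_right x s).deriv]
  have e3 : (fun s => deriv (fun t => k.eval t s) x)
      = fun s => x * k.polyR (x ^ 2 / 2) (s ^ 2 / 2) := by
    funext s
    rw [(k.hasDerivAt_left x s).deriv]
  have hsq : ∀ a : ℝ, HasDerivAt (fun s : ℝ => s ^ 2 / 2) a a := fun a =>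
    (((hasDerivAt_id a).pow 2).div_const 2).congr_deriv (by simp)
  have d1 : HasDerivAt (fun s => s * k.polyR (s ^ 2 / 2) 0) (k.polyR (x ^ 2 / 2) 0
      + x ^ 2 * (2 * (k.F2 + k.G1) + 3 * (k.F3 + k.G2) * x ^ 2)) x := by
    have hp : HasDerivAt (fun s : ℝ => (k.F1 + k.G0) + 2 * (k.F2 + k.G1) * (s ^ 2 / 2)
        + 3 * (k.F3 + k.G2) * (s ^ 2 / 2) ^ 2)
        (2 * (k.F2 + k.G1) * x + 3 * (k.F3 + k.G2) * (2 * (x ^ 2 / 2) * x)) x := by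
      refine ((((hsq x).const_mul _).const_add _).add
        (((hsq x).pow 2).const_mul _)).congr_deriv ?_
      push_cast; ring
    refine (((hasDerivAt_id x).mul hp).congr_deriv ?_).congr_of_eventuallyEq
      (Eventually.of_forall fun s => ?_)
    · simp only [polyR, id]; ring
    · simp only [polyR, Pi.mul_apply, id]; ring
  have d2 : HasDerivAt (fun s => s * k.polyZ (x ^ 2 / 2) (s ^ 2 / 2))
      (k.polyZ (x ^ 2 / 2) 0) 0 := by
    have hz : Continuous fun s => k.polyZ (x ^ 2 / 2) (s ^ 2 / 2) := by
      unfold polyZ; fun_prop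
    have hd : DifferentiableAt ℝ (fun s => k.polyZ (x ^ 2 / 2) (s ^ 2 / 2)) 0 := by
      unfold polyZ; fun_prop
    refine ((hasDerivAt_id (0 : ℝ)).mul hd.hasDerivAt).congr_deriv ?_
    simp
  have d3 := k.hasDerivAt_mixed x
  unfold hessDet
  rw [e1, e2, e3, d1.deriv, d2.deriv, d3.deriv]
  ring

theorem hessDet_swap_axis (k : EvenHam) (y : ℝ) :
    hessDet k.eval 0 y = hessDet k.swap.eval y 0 := by
  have e1 : (fun s => deriv (fun t => k.eval t s) 0) = fun _ => 0 := by
    funext s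
    rw [(k.hasDerivAt_left 0 s).deriv, zero_mul]
  have e2 : (fun s => deriv (fun t => k.swap.eval t s) y)
      = fun s => y * k.swap.polyR (y ^ 2 / 2) (s ^ 2 / 2) := by
    funext s
    rw [(k.swap.hasDerivAt_left y s).deriv]
  have hd := k.swap.hasDerivAt_mixed y
  unfold hessDet
  rw [e1, e2, hd.deriv]
  simp only [swap_eval, deriv_const]
  ring

theorem isStrictExtremum_swap {k : EvenHam} {x y : ℝ} (h : IsStrictExtremum k.swap.eval x y) :
    IsStrictExtremum k.eval y x := by
  obtain ⟨σ, ε, hε, H⟩ := h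
  refine ⟨σ, ε, hε, fun x' y' h1 h2 => ?_⟩
  have := H y' x' (by linarith) (by linarith)
  rwa [swap_eval, swap_eval] at this

theorem isEquilibrium_swap {k : EvenHam} {x y : ℝ} :
    IsEquilibrium k.eval y x ↔ IsEquilibrium k.swap.eval x y := by
  rw [isEquilibrium_iff, isEquilibrium_iff, swap_polyR, swap_polyZ, and_comm]

/-! ### Fixed points near the origin -/

/-- Along the `x`-axis, with `r = x² / 2`, the Hamiltonian is `c + a r + q r² + K r³` where
`a = F₁ + G₀`, `q = F₂ + G₁`, `K = F₃ + G₂`. These are sign conditions, on a disc of radius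
`√(2R)`, which confine the fixed points to the
`x`-axis (`polyZ`, `quotZ`) and make the restriction to it strictly convex (`σ > 0`) or concave
(`σ < 0`) in `r`. -/
structure Controlled (k : EvenHam) (σ R : ℝ) : Prop where
  polyZ_pos : ∀ r z, 0 ≤ r → 0 ≤ z → r + z ≤ R → 0 < σ * k.polyZ r z
  quotZ_pos : ∀ r z, 0 ≤ r → 0 ≤ z → r + z ≤ R → 0 < σ * k.quotZ r z
  convex : ∀ r, 0 ≤ r → r ≤ R → 0 < σ * (k.F2 + k.G1 + 3 * (k.F3 + k.G2) * r)

theorem Controlled.eq_zero {k : EvenHam} {σ R : ℝ} (hk : k.Controlled σ R) {x y : ℝ}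
    (hxy : x ^ 2 + y ^ 2 ≤ 2 * R) (he : IsEquilibrium k.eval x y) : y = 0 := by
  have h := ((k.isEquilibrium_iff x y).1 he).2
  have hp := hk.polyZ_pos (x ^ 2 / 2) (y ^ 2 / 2) (by positivity) (by positivity) (by linarith)
  rcases mul_eq_zero.1 h with h | h
  · exact h
  · rw [h, mul_zero] at hp; exact absurd hp (lt_irrefl 0)

theorem poly_sub_axis (k : EvenHam) (r z : ℝ) : k.poly r z - k.poly r 0 = z * k.quotZ r z := by
  unfold poly quotZ; ring

theorem Controlled.poly_ge {k : EvenHam} {σ R : ℝ} (hk : k.Controlled σ R) {r z : ℝ}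
    (hr : 0 ≤ r) (hz : 0 ≤ z) (hR : r + z ≤ R) :
    0 ≤ σ * (k.poly r z - k.poly r 0) ∧ (0 < z → 0 < σ * (k.poly r z - k.poly r 0)) := by
  have hp := hk.quotZ_pos r z hr hz hR
  have e : σ * (k.poly r z - k.poly r 0) = z * (σ * k.quotZ r z) := by
    rw [poly_sub_axis]; ring
  rw [e]
  exact ⟨mul_nonneg hz hp.le, fun h => mul_pos h hp⟩

theorem origin_isEquilibrium (k : EvenHam) : IsEquilibrium k.eval 0 0 := by
  rw [isEquilibrium_iff]; simp

theorem hessDet_origin (k : EvenHam) :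
    hessDet k.eval 0 0 = (k.F1 + k.G0) * (k.F1 - k.G0) := by
  rw [hessDet_axis]; simp [polyR, polyZ]

theorem Controlled.b_pos {k : EvenHam} {σ R : ℝ} (hk : k.Controlled σ R) (hR : 0 < R) :
    0 < σ * (k.F1 - k.G0) := by
  have := hk.polyZ_pos 0 0 le_rfl le_rfl (by linarith)
  simpa [polyZ] using this

/-- Off the bifurcation, on the side where `a` has the sign of `q`, the origin is an extremum. -/
theorem Controlled.isStrictExtremum_origin {k : EvenHam} {σ R : ℝ} (hk : k.Controlled σ R)
    (hR : 0 < R) (ha : 0 < σ * (k.F1 + k.G0)) : IsStrictExtremum k.eval 0 0 := by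
  refine ⟨σ, √R, Real.sqrt_pos.2 hR, fun x y h0 h1 => ?_⟩
  rw [Real.sq_sqrt hR.le] at h1
  simp only [sub_zero] at h0 h1
  set r := x ^ 2 / 2 with hr
  have hr0 : 0 ≤ r := by positivity
  have hz0 : 0 ≤ y ^ 2 / 2 := by positivity
  obtain ⟨g1, g2⟩ := hk.poly_ge hr0 hz0 (by linarith)
  have hc0 := hk.convex 0 le_rfl hR.le
  have hcr := hk.convex r hr0 (by linarith)
  have e : σ * (k.eval x y - k.eval 0 0) = σ * (k.poly r (y ^ 2 / 2) - k.poly r 0)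
      + r * (σ * (k.F1 + k.G0) + r * (2 / 3 * (σ * (k.F2 + k.G1 + 3 * (k.F3 + k.G2) * 0))
        + 1 / 3 * (σ * (k.F2 + k.G1 + 3 * (k.F3 + k.G2) * r)))) := by
    simp only [eval, poly, ← hr]; ring
  rw [e]
  have hin : 0 < σ * (k.F1 + k.G0) + r * (2 / 3 * (σ * (k.F2 + k.G1 + 3 * (k.F3 + k.G2) * 0))
        + 1 / 3 * (σ * (k.F2 + k.G1 + 3 * (k.F3 + k.G2) * r))) := by positivity
  rcases hr0.lt_or_eq with h | h
  · have := mul_pos h hin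
    linarith
  · have : 0 < y ^ 2 / 2 := by linarith
    have h2 := g2 this
    rw [← h] at h2 ⊢
    linarith

/-- On that side the origin is the only fixed point of the disc. -/
theorem Controlled.eq_origin {k : EvenHam} {σ R : ℝ} (hk : k.Controlled σ R)
    (ha : 0 < σ * (k.F1 + k.G0)) {x y : ℝ}
    (hxy : x ^ 2 + y ^ 2 ≤ 2 * R) (he : IsEquilibrium k.eval x y) : x = 0 ∧ y = 0 := by
  have hy := hk.eq_zero hxy he
  refine ⟨?_, hy⟩
  have h := ((k.isEquilibrium_iff x y).1 he).1
  rcases mul_eq_zero.1 h with h | h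
  · exact h
  exfalso
  subst hy
  set r := x ^ 2 / 2 with hr
  have hr0 : 0 ≤ r := by positivity
  have hrR : r ≤ R := by nlinarith
  have hc0 := hk.convex 0 le_rfl (hr0.trans hrR)
  have hcr := hk.convex r hr0 hrR
  have e : σ * k.polyR r (0 ^ 2 / 2) = σ * (k.F1 + k.G0)
      + r * ((σ * (k.F2 + k.G1 + 3 * (k.F3 + k.G2) * 0))
        + (σ * (k.F2 + k.G1 + 3 * (k.F3 + k.G2) * r))) := by
    simp only [polyR]; ring
  have : 0 < σ * k.polyR r (0 ^ 2 / 2) := by rw [e]; positivity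
  rw [h, mul_zero] at this
  exact lt_irrefl 0 this

theorem Controlled.hessDet_pair {k : EvenHam} {σ R : ℝ} (hk : k.Controlled σ R) {s : ℝ}
    (hs : s ≠ 0) (hsR : s ^ 2 / 2 ≤ R) (h0 : k.polyR (s ^ 2 / 2) 0 = 0) :
    0 < hessDet k.eval s 0 := by
  have hs2 : 0 < s ^ 2 := by positivity
  have hc := hk.convex (s ^ 2 / 2) (by positivity) hsR
  have hz := hk.polyZ_pos (s ^ 2 / 2) 0 (by positivity) le_rfl (by linarith)
  have h2 := mul_pos hs2 (mul_pos hc hz)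
  have hσ : 0 < σ ^ 2 := by
    have : σ ≠ 0 := by rintro rfl; simp at hc
    positivity
  rw [hessDet_axis, h0]
  refine pos_of_mul_pos_right (a := σ ^ 2) ?_ hσ.le
  calc 0 < 2 * (s ^ 2 * (σ * (k.F2 + k.G1 + 3 * (k.F3 + k.G2) * (s ^ 2 / 2))
        * (σ * k.polyZ (s ^ 2 / 2) 0))) := by linarith
    _ = _ := by ring

/-- A critical point of the restriction to the `x`-axis off the origin is a strict extremum: there
`r = x² / 2` is a local coordinate, in which the restriction is strictly convex or concave. -/
theorem Controlled.isStrictExtremum_pair {k : EvenHam} {σ R : ℝ} (hk : k.Controlled σ R) {s : ℝ}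
    (hs : s ≠ 0) (hsR : s ^ 2 / 2 < R) (h0 : k.polyR (s ^ 2 / 2) 0 = 0) :
    IsStrictExtremum k.eval s 0 := by
  -- in a disc of radius `< |s|` around `(s, 0)` the equation `x² = s²` forces `x = s`
  have hev : ∀ᶠ w : ℝ × ℝ in 𝓝 (s, 0), w.1 ^ 2 / 2 + w.2 ^ 2 / 2 < R ∧ 0 < w.1 * s := by
    refine Filter.Eventually.and ?_ ?_
    · refine ContinuousAt.eventually_lt (by fun_prop) continuousAt_const ?_
      simpa using hsR
    · refine ContinuousAt.eventually_lt continuousAt_const (by fun_prop) ?_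
      simpa using mul_self_pos.2 hs
  obtain ⟨ε, hε, hball⟩ := Metric.eventually_nhds_iff.1 hev
  refine ⟨σ, ε / 2, by positivity, fun x y hpos hle => ?_⟩
  rw [sub_zero] at hpos hle
  obtain ⟨hR, hxs⟩ := hball (y := (x, y)) (by
    rw [Prod.dist_eq, max_lt_iff, Real.dist_eq, Real.dist_eq]
    refine ⟨abs_lt_of_sq_lt_sq ?_ hε.le, abs_lt_of_sq_lt_sq ?_ hε.le⟩
    · simp only; nlinarith [sq_nonneg y]
    · simp only [sub_zero]; nlinarith [sq_nonneg (x - s)])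
  simp only at hR hxs
  set r := x ^ 2 / 2 with hr
  set r₀ := s ^ 2 / 2 with hr₀
  have hr0 : 0 ≤ r := by positivity
  have hr₀0 : 0 ≤ r₀ := by positivity
  have hz0 : 0 ≤ y ^ 2 / 2 := by positivity
  obtain ⟨g1, g2⟩ := hk.poly_ge hr0 hz0 hR.le
  have hc0 := hk.convex r₀ hr₀0 hsR.le
  have hcr := hk.convex r hr0 (by linarith)
  have hcrit : k.F1 + k.G0 = -(2 * (k.F2 + k.G1) * r₀ + 3 * (k.F3 + k.G2) * r₀ ^ 2) := by
    have : k.polyR r₀ 0 = k.F1 + k.G0 + (2 * (k.F2 + k.G1) * r₀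
      + 3 * (k.F3 + k.G2) * r₀ ^ 2) := by unfold polyR; ring
    linarith
  have e : σ * (k.eval x y - k.eval s 0) = σ * (k.poly r (y ^ 2 / 2) - k.poly r 0)
      + (r - r₀) ^ 2 * (2 / 3 * (σ * (k.F2 + k.G1 + 3 * (k.F3 + k.G2) * r₀))
        + 1 / 3 * (σ * (k.F2 + k.G1 + 3 * (k.F3 + k.G2) * r))) := by
    have e1 : k.poly r 0 - k.poly r₀ 0 = (k.F1 + k.G0) * (r - r₀)
        + (k.F2 + k.G1) * (r ^ 2 - r₀ ^ 2) + (k.F3 + k.G2) * (r ^ 3 - r₀ ^ 3) := by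
      unfold poly; ring
    have e2 : k.eval x y - k.eval s 0
        = (k.poly r (y ^ 2 / 2) - k.poly r 0) + (k.poly r 0 - k.poly r₀ 0) := by
      simp only [eval, ← hr, ← hr₀]; norm_num
    rw [e2, e1, hcrit]; ring
  rw [e]
  by_cases hrr : r = r₀
  · have hx : x = s := by
      have h1 : (x - s) * (x + s) = 0 := by
        have : x ^ 2 = s ^ 2 := by rw [hr, hr₀] at hrr; linarith
        linear_combination this
      rcases mul_eq_zero.1 h1 with h | h
      · linarith
      · exfalso
        have : x = -s := by linarith
        rw [this] at hxs
        nlinarith [sq_nonneg s]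
    rw [hx] at hpos
    have := g2 (by simp at hpos; positivity)
    have h3 : 0 ≤ (r - r₀) ^ 2 * (2 / 3 * (σ * (k.F2 + k.G1 + 3 * (k.F3 + k.G2) * r₀))
        + 1 / 3 * (σ * (k.F2 + k.G1 + 3 * (k.F3 + k.G2) * r))) := by positivity
    linarith
  · have h2 : 0 < (r - r₀) ^ 2 := by
      have : r - r₀ ≠ 0 := sub_ne_zero.2 hrr
      positivity
    have h3 : 0 < (r - r₀) ^ 2 * (2 / 3 * (σ * (k.F2 + k.G1 + 3 * (k.F3 + k.G2) * r₀))
        + 1 / 3 * (σ * (k.F2 + k.G1 + 3 * (k.F3 + k.G2) * r))) := by positivity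
    linarith

/-- Besides the origin, the fixed points of the disc are at most the two with `x² = s²`. -/
theorem Controlled.eq_origin_or_pair {k : EvenHam} {σ R : ℝ} (hk : k.Controlled σ R) {s : ℝ}
    (hsR : s ^ 2 / 2 ≤ R) (h0 : k.polyR (s ^ 2 / 2) 0 = 0) {x y : ℝ}
    (hxy : x ^ 2 + y ^ 2 ≤ 2 * R) (he : IsEquilibrium k.eval x y) :
    (x = 0 ∧ y = 0) ∨ (x = s ∧ y = 0) ∨ (x = -s ∧ y = 0) := by
  have hy := hk.eq_zero hxy he
  subst hy
  simp only [and_true]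
  rcases mul_eq_zero.1 ((k.isEquilibrium_iff x 0).1 he).1 with h | h
  · exact Or.inl h
  right
  set r := x ^ 2 / 2 with hr
  set r₀ := s ^ 2 / 2 with hr₀
  have hc0 := hk.convex r₀ (by positivity) hsR
  have hcr := hk.convex r (by positivity) (by nlinarith)
  have e : (r - r₀) * (σ * (k.F2 + k.G1 + 3 * (k.F3 + k.G2) * r₀)
      + σ * (k.F2 + k.G1 + 3 * (k.F3 + k.G2) * r)) = 0 := by
    have : (r - r₀) * (σ * (k.F2 + k.G1 + 3 * (k.F3 + k.G2) * r₀)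
      + σ * (k.F2 + k.G1 + 3 * (k.F3 + k.G2) * r))
        = σ * (k.polyR r (0 ^ 2 / 2) - k.polyR r₀ 0) := by unfold polyR; ring
    rw [this, h, h0]; ring
  rcases mul_eq_zero.1 e with h1 | h1
  · have h2 : (x - s) * (x + s) = 0 := by
      rw [hr, hr₀] at h1; linear_combination 2 * h1
    rcases mul_eq_zero.1 h2 with h | h
    · left; linarith
    · right; linarith
  · linarith

/-- On the side where `a` and `q` have opposite signs, a critical point branches off along the
`x`-axis, at a distance that is controlled by `a`. -/
theorem Controlled.exists_pair {k : EvenHam} {σ R m : ℝ} (hk : k.Controlled σ R) (hR : 0 < R)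
    (hm : 0 < m) (hmq : m ≤ σ * (k.F2 + k.G1)) (ha : σ * (k.F1 + k.G0) < 0)
    (hpos : 0 < σ * k.polyR (R / 2) 0) :
    ∃ s, 0 < s ∧ s ^ 2 / 2 < R ∧ k.polyR (s ^ 2 / 2) 0 = 0 ∧
      s ^ 2 ≤ 2 * |k.F1 + k.G0| * |σ| / m := by
  have hcont : ContinuousOn (fun r => σ * k.polyR r 0) (Icc 0 (R / 2)) := by
    unfold polyR; fun_prop
  obtain ⟨r, hr, hr0⟩ := intermediate_value_Icc (by positivity) hcont
    (show (0 : ℝ) ∈ Icc (σ * k.polyR 0 0) (σ * k.polyR (R / 2) 0) from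
      ⟨by simpa [polyR] using ha.le, hpos.le⟩)
  simp only at hr0
  have hc0 := hk.convex 0 le_rfl hR.le
  have hσ : σ ≠ 0 := by rintro rfl; simp at hc0
  have hcr := hk.convex r hr.1 (by linarith [hr.2])
  have hrpos : 0 < r := by
    rcases hr.1.lt_or_eq with h | h
    · exact h
    · rw [← h] at hr0; simp only [polyR] at hr0; exfalso; norm_num at hr0
      rcases hr0 with h | h
      · exact hσ h
      · rw [h] at ha; simp at ha
  have hs2 : √(2 * r) ^ 2 = 2 * r := Real.sq_sqrt (by linarith)
  have hs2' : √(2 * r) ^ 2 / 2 = r := by rw [hs2]; ring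
  refine ⟨√(2 * r), Real.sqrt_pos.2 (by linarith), ?_, ?_, ?_⟩
  · rw [hs2']; linarith [hr.2]
  · rw [hs2']; exact (mul_eq_zero.1 hr0).resolve_left hσ
  · rw [hs2, le_div_iff₀ hm]
    have e : σ * k.polyR r 0 = σ * (k.F1 + k.G0) + r * (σ * (k.F2 + k.G1)
        + σ * (k.F2 + k.G1 + 3 * (k.F3 + k.G2) * r)) := by unfold polyR; ring
    rw [e] at hr0
    have h1 : -(σ * (k.F1 + k.G0)) ≤ |k.F1 + k.G0| * |σ| := by
      rw [mul_comm, ← abs_mul, mul_comm]; exact neg_le_abs _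
    nlinarith [mul_le_mul_of_nonneg_left hmq hrpos.le, mul_pos hrpos hcr]

/-! ### Pitchforks in families of even polynomials -/

theorem swap_swap (k : EvenHam) : k.swap.swap = k := by
  cases k; simp [swap]

theorem Controlled.onlyOrigin {k : EvenHam} {σ r : ℝ} (hr : 0 < r)
    (hk : k.Controlled σ (r ^ 2 / 2)) (ha : 0 < σ * (k.F1 + k.G0)) : OnlyOrigin k.eval r := by
  have hR : 0 < r ^ 2 / 2 := by positivity
  have hb := hk.b_pos hR
  refine ⟨⟨k.origin_isEquilibrium, ?_,
    (hk.isStrictExtremum_origin hR ha).lyapunovStable k.differentiable_eval⟩,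
    fun x y hxy he => hk.eq_origin ha (by linarith) he⟩
  rw [hessDet_origin]
  refine pos_of_mul_pos_right (a := σ ^ 2) ?_ (sq_nonneg σ)
  calc 0 < _ := mul_pos ha hb
    _ = _ := by ring

theorem Controlled.onlyOrigin_swap {k : EvenHam} {σ r : ℝ} (hr : 0 < r)
    (hk : k.Controlled σ (r ^ 2 / 2)) (ha : 0 < σ * (k.F1 + k.G0)) :
    OnlyOrigin k.swap.eval r := by
  obtain ⟨⟨-, h2, -⟩, h4⟩ := hk.onlyOrigin hr ha
  have h3 := hk.isStrictExtremum_origin (by positivity) ha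
  refine ⟨⟨k.swap.origin_isEquilibrium, ?_, ?_⟩, fun x y hxy he => ?_⟩
  · rwa [hessDet_swap_axis, swap_swap]
  · rw [← k.swap_swap] at h3
    exact (isStrictExtremum_swap h3).lyapunovStable k.swap.differentiable_eval
  · exact (h4 y x (by linarith) (isEquilibrium_swap.2 he)).symm

/-- The assertion that `s` is the branching critical point on the `x`-axis. -/
def IsBranch (k : EvenHam) (r s : ℝ) : Prop :=
  0 < s ∧ s ^ 2 < r ^ 2 ∧ k.polyR (s ^ 2 / 2) 0 = 0

theorem Controlled.origin_unstable {k : EvenHam} {σ R : ℝ} (hR : 0 < R)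
    (hk : k.Controlled σ R) (ha : σ * (k.F1 + k.G0) < 0) :
    IsUnstablePoint k.eval 0 0 := by
  refine ⟨k.origin_isEquilibrium, ?_⟩
  have hb := hk.b_pos hR
  rw [hessDet_origin]
  have h : σ ^ 2 * ((k.F1 + k.G0) * (k.F1 - k.G0)) < 0 := by
    calc _ = σ * (k.F1 + k.G0) * (σ * (k.F1 - k.G0)) := by ring
      _ < 0 := mul_neg_of_neg_of_pos ha hb
  by_contra! hge
  exact absurd h (not_lt.2 (mul_nonneg (sq_nonneg σ) hge))

theorem IsBranch.isEquilibrium {k : EvenHam} {r s : ℝ} (hs : k.IsBranch r s) :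
    IsEquilibrium k.eval s 0 := by
  rw [isEquilibrium_iff]
  have h := hs.2.2
  norm_num [h]

theorem IsBranch.isEquilibrium_neg {k : EvenHam} {r s : ℝ} (hs : k.IsBranch r s) :
    IsEquilibrium k.eval (-s) 0 := by
  rw [isEquilibrium_iff]
  have h := hs.2.2
  norm_num [h]

theorem Controlled.originAndPair {k : EvenHam} {σ r s : ℝ}
    (hk : k.Controlled σ (r ^ 2 / 2)) (hs : k.IsBranch r s) (ha : σ * (k.F1 + k.G0) < 0) :
    OriginAndPair k.eval r s 0 := by
  have ⟨h1, h2, h3⟩ := hs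
  have h3' : k.polyR ((-s) ^ 2 / 2) 0 = 0 := by rwa [neg_sq]
  have h2' : (-s) ^ 2 / 2 < r ^ 2 / 2 := by rw [neg_sq]; linarith
  refine ⟨hk.origin_unstable (by nlinarith [sq_nonneg s]) ha, by positivity, by linarith,
    ⟨hs.isEquilibrium, hk.hessDet_pair h1.ne' (by linarith) h3,
      (hk.isStrictExtremum_pair h1.ne' (by linarith) h3).lyapunovStable k.differentiable_eval⟩,
    ?_, fun x y hxy he => ?_⟩
  · rw [neg_zero]
    exact ⟨hs.isEquilibrium_neg, hk.hessDet_pair (neg_ne_zero.2 h1.ne') h2'.le h3',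
      (hk.isStrictExtremum_pair (neg_ne_zero.2 h1.ne') h2' h3').lyapunovStable
        k.differentiable_eval⟩
  · rw [neg_zero]
    exact hk.eq_origin_or_pair (by linarith) h3 (by linarith) he

theorem Controlled.originAndPair_swap {k : EvenHam} {σ r s : ℝ}
    (hk : k.Controlled σ (r ^ 2 / 2)) (hs : k.IsBranch r s) (ha : σ * (k.F1 + k.G0) < 0) :
    OriginAndPair k.swap.eval r 0 s := by
  have ⟨h1, h2, h3⟩ := hs
  have h3' : k.polyR ((-s) ^ 2 / 2) 0 = 0 := by rwa [neg_sq]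
  have h2' : (-s) ^ 2 / 2 < r ^ 2 / 2 := by rw [neg_sq]; linarith
  obtain ⟨⟨-, hu⟩, hp, hlt, ⟨e1, d1, -⟩, ⟨e2, d2, -⟩, huniq⟩ := hk.originAndPair hs ha
  have x1 := hk.isStrictExtremum_pair h1.ne' (by linarith) h3
  have x2 := hk.isStrictExtremum_pair (neg_ne_zero.2 h1.ne') h2' h3'
  rw [neg_zero] at e2 d2 huniq
  rw [← k.swap_swap] at e1 d1 e2 d2 x1 x2 hu
  refine ⟨⟨k.swap.origin_isEquilibrium, ?_⟩, by linarith, by linarith,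
    ⟨isEquilibrium_swap.2 e1, ?_,
      (isStrictExtremum_swap x1).lyapunovStable k.swap.differentiable_eval⟩,
    ⟨by rw [neg_zero]; exact isEquilibrium_swap.2 e2, ?_,
      by rw [neg_zero]; exact (isStrictExtremum_swap x2).lyapunovStable k.swap.differentiable_eval⟩,
    fun x y hxy he => ?_⟩
  · rwa [hessDet_swap_axis]
  · rwa [hessDet_swap_axis]
  · rwa [neg_zero, hessDet_swap_axis]
  · rw [neg_zero]
    have := huniq y x (by linarith) (isEquilibrium_swap.2 he)
    tauto

/-- A family of even polynomials with continuous coefficients. -/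
structure ContinuousFamily (k : ℝ → EvenHam) : Prop where
  F1 : Continuous fun E => (k E).F1
  F2 : Continuous fun E => (k E).F2
  F3 : Continuous fun E => (k E).F3
  G0 : Continuous fun E => (k E).G0
  G1 : Continuous fun E => (k E).G1
  G2 : Continuous fun E => (k E).G2

theorem ContinuousFamily.exists_controlled {k : ℝ → EvenHam} (hk : ContinuousFamily k)
    {σ Ec : ℝ} (hb : 0 < σ * ((k Ec).F1 - (k Ec).G0)) (hq : 0 < σ * ((k Ec).F2 + (k Ec).G1)) :
    ∃ ε > 0, ∀ R, R < ε → ∀ᶠ E in 𝓝 Ec, (k E).Controlled σ R := by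
  have c1 := hk.F1.comp (continuous_fst (X := ℝ) (Y := ℝ × ℝ))
  have c2 := hk.F2.comp (continuous_fst (X := ℝ) (Y := ℝ × ℝ))
  have c3 := hk.F3.comp (continuous_fst (X := ℝ) (Y := ℝ × ℝ))
  have c4 := hk.G0.comp (continuous_fst (X := ℝ) (Y := ℝ × ℝ))
  have c5 := hk.G1.comp (continuous_fst (X := ℝ) (Y := ℝ × ℝ))
  have c6 := hk.G2.comp (continuous_fst (X := ℝ) (Y := ℝ × ℝ))
  simp only [Function.comp_def] at c1 c2 c3 c4 c5 c6
  have hev : ∀ᶠ w : ℝ × ℝ × ℝ in 𝓝 (Ec, 0, 0), 0 < σ * (k w.1).polyZ w.2.1 w.2.2 ∧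
      0 < σ * (k w.1).quotZ w.2.1 w.2.2 ∧
      0 < σ * ((k w.1).F2 + (k w.1).G1 + 3 * ((k w.1).F3 + (k w.1).G2) * w.2.1) := by
    refine Filter.Eventually.and ?_ (Filter.Eventually.and ?_ ?_)
    · refine ContinuousAt.eventually_lt continuousAt_const
        (Continuous.continuousAt (by unfold polyZ; fun_prop)) ?_
      simpa [polyZ] using hb
    · refine ContinuousAt.eventually_lt continuousAt_const
        (Continuous.continuousAt (by unfold quotZ; fun_prop)) ?_
      simpa [quotZ] using hb
    · refine ContinuousAt.eventually_lt continuousAt_const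
        (Continuous.continuousAt (by fun_prop)) ?_
      simpa using hq
  obtain ⟨ε, hε, hball⟩ := Metric.eventually_nhds_iff.1 hev
  refine ⟨ε, hε, fun R hR => ?_⟩
  filter_upwards [Metric.ball_mem_nhds Ec hε] with E hE
  have key : ∀ r z, 0 ≤ r → 0 ≤ z → r + z ≤ R → dist ((E, r, z) : ℝ × ℝ × ℝ) (Ec, 0, 0) < ε := by
    intro r z hr hz hrz
    simp only [Prod.dist_eq, max_lt_iff, Real.dist_eq, sub_zero]
    refine ⟨hE, ?_, ?_⟩
    · rw [abs_of_nonneg hr]; linarith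
    · rw [abs_of_nonneg hz]; linarith
  exact ⟨fun r z h1 h2 h3 => (hball (key r z h1 h2 h3)).1,
    fun r z h1 h2 h3 => (hball (key r z h1 h2 h3)).2.1,
    fun r h1 h2 => (hball (key r 0 h1 le_rfl (by linarith))).2.2⟩

/-- Near a zero `Ec` of `a` the fixed points in a fixed disc are controlled, and a branch of
critical points which tends to the origin exists wherever `a` and `q` have opposite signs. -/
theorem ContinuousFamily.exists_branch {k : ℝ → EvenHam} (hk : ContinuousFamily k)
    {σ Ec : ℝ} (hEc : 0 < Ec) (ha : (k Ec).F1 + (k Ec).G0 = 0)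
    (hb : 0 < σ * ((k Ec).F1 - (k Ec).G0)) (hq : 0 < σ * ((k Ec).F2 + (k Ec).G1)) :
    ∃ r > 0, r ^ 2 < Ec ∧ ∃ s : ℝ → ℝ, Tendsto s (𝓝 Ec) (𝓝 0) ∧
      ∀ᶠ E in 𝓝 Ec, (k E).Controlled σ (r ^ 2 / 2) ∧
        (σ * ((k E).F1 + (k E).G0) < 0 → (k E).IsBranch r (s E)) := by
  classical
  obtain ⟨ε, hε, hcon⟩ := hk.exists_controlled hb hq
  obtain ⟨c1, c2, c3, c4, c5, c6⟩ := hk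
  obtain ⟨r, hr, hrε⟩ : ∃ r : ℝ, 0 < r ∧ r ^ 2 < min ε Ec := by
    refine ⟨√(min ε Ec / 2), Real.sqrt_pos.2 (by positivity), ?_⟩
    have : 0 < min ε Ec := lt_min hε hEc
    rw [Real.sq_sqrt (by positivity)]
    linarith
  have hR : 0 < r ^ 2 / 2 := by positivity
  set m := σ * ((k Ec).F2 + (k Ec).G1) / 2 with hm
  have hm0 : 0 < m := by positivity
  have hcon' := hcon (r ^ 2 / 2) (by linarith [min_le_left ε Ec])
  have hpos : 0 < σ * (k Ec).polyR (r ^ 2 / 2 / 2) 0 := by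
    have hc := hcon'.self_of_nhds
    have h1 := hc.convex 0 le_rfl hR.le
    have h2 := hc.convex (r ^ 2 / 2 / 2) (by positivity) (by linarith)
    have e : σ * (k Ec).polyR (r ^ 2 / 2 / 2) 0
        = (r ^ 2 / 2 / 2) * (σ * ((k Ec).F2 + (k Ec).G1 + 3 * ((k Ec).F3 + (k Ec).G2) * 0)
          + σ * ((k Ec).F2 + (k Ec).G1
            + 3 * ((k Ec).F3 + (k Ec).G2) * (r ^ 2 / 2 / 2))) := by
      have e0 : (k Ec).polyR (r ^ 2 / 2 / 2) 0 = ((k Ec).F1 + (k Ec).G0)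
          + (2 * ((k Ec).F2 + (k Ec).G1) * (r ^ 2 / 2 / 2)
            + 3 * ((k Ec).F3 + (k Ec).G2) * (r ^ 2 / 2 / 2) ^ 2) := by unfold polyR; ring
      rw [e0, ha]; ring
    rw [e]; positivity
  have hposE : ∀ᶠ E in 𝓝 Ec, 0 < σ * (k E).polyR (r ^ 2 / 2 / 2) 0 :=
    ContinuousAt.eventually_lt continuousAt_const
      (Continuous.continuousAt (by unfold polyR; fun_prop)) hpos
  have hmE : ∀ᶠ E in 𝓝 Ec, m < σ * ((k E).F2 + (k E).G1) :=
    ContinuousAt.eventually_lt continuousAt_const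
      (Continuous.continuousAt (by fun_prop)) (by linarith)
  let P : ℝ → ℝ → Prop := fun E s => (k E).IsBranch r s ∧
    s ^ 2 ≤ 2 * |(k E).F1 + (k E).G0| * |σ| / m
  let s : ℝ → ℝ := fun E => if h : ∃ s, P E s then h.choose else 0
  have hs : ∀ E, (∃ s, P E s) → P E (s E) := fun E h => by
    simp only [s, dif_pos h]; exact h.choose_spec
  have hsb : ∀ E, (s E) ^ 2 ≤ 2 * |(k E).F1 + (k E).G0| * |σ| / m := fun E => by
    by_cases h : ∃ s, P E s
    · exact (hs E h).2
    · simp only [s, dif_neg h]; rw [zero_pow two_ne_zero]; positivity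
  refine ⟨r, hr, hrε.trans_le (min_le_right _ _), s, ?_, ?_⟩
  · have h1 : Tendsto (fun E => √(2 * |(k E).F1 + (k E).G0| * |σ| / m)) (𝓝 Ec) (𝓝 0) := by
      have : Continuous fun E => √(2 * |(k E).F1 + (k E).G0| * |σ| / m) := by fun_prop
      have h2 := this.tendsto Ec
      simpa [ha] using h2
    refine squeeze_zero_norm (fun E => ?_) h1
    rw [Real.norm_eq_abs]
    exact Real.abs_le_sqrt (hsb E)
  · filter_upwards [hcon', hposE, hmE] with E h1 h2 h3
    refine ⟨h1, fun hneg => ?_⟩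
    obtain ⟨t, t1, t2, t3, t4⟩ := h1.exists_pair hR hm0 h3.le hneg h2
    exact (hs E ⟨t, ⟨t1, by linarith, t3⟩, t4⟩).1

theorem exists_halfwidth {p : ℝ → Prop} {Ec : ℝ} (hEc : 0 < Ec) (hp : ∀ᶠ E in 𝓝 Ec, p E) :
    ∃ η > 0, η ≤ Ec / 2 ∧ ∀ E ∈ Ioo (Ec - η) (Ec + η), p E := by
  obtain ⟨ε, hε, h⟩ := Metric.eventually_nhds_iff.1 hp
  refine ⟨min ε (Ec / 2), lt_min hε (by linarith), min_le_right _ _, fun E hE => h ?_⟩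
  rw [Real.dist_eq, abs_lt]
  have := min_le_left ε (Ec / 2)
  exact ⟨by linarith [hE.1], by linarith [hE.2]⟩

section Bifurcations

variable {k : ℝ → EvenHam} {σ Ec : ℝ}

theorem ContinuousFamily.pitchforkAt (hk : ContinuousFamily k) (hEc : 0 < Ec)
    (ha : (k Ec).F1 + (k Ec).G0 = 0)
    (hb : 0 < σ * ((k Ec).F1 - (k Ec).G0)) (hq : 0 < σ * ((k Ec).F2 + (k Ec).G1))
    (hsign : ∀ᶠ E in 𝓝 Ec, (E < Ec → 0 < σ * ((k E).F1 + (k E).G0)) ∧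
      (Ec < E → σ * ((k E).F1 + (k E).G0) < 0)) :
    PitchforkAt (fun E => (k E).eval) 1 0 Ec ∧ PitchforkAt (fun E => (k E).swap.eval) 0 1 Ec := by
  obtain ⟨r, hr, hrE, s, hs, hev⟩ := hk.exists_branch hEc ha hb hq
  obtain ⟨η, hη, hηE, h⟩ := exists_halfwidth hEc (hev.and hsign)
  refine ⟨⟨η, hη, r, hr, by linarith, s, fun E hE => ?_, fun E hE => ?_,
    hs.mono_left nhdsWithin_le_nhds⟩, ⟨η, hη, r, hr, by linarith, s, fun E hE => ?_,
    fun E hE => ?_, hs.mono_left nhdsWithin_le_nhds⟩⟩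
  all_goals
    obtain ⟨⟨h1, h2⟩, h3, h4⟩ := h E ⟨by linarith [hE.1], by linarith [hE.2]⟩
    try rw [mul_one, mul_zero]
  · exact h1.onlyOrigin hr (h3 hE.2)
  · exact h1.originAndPair (h2 (h4 hE.1)) (h4 hE.1)
  · exact h1.onlyOrigin_swap hr (h3 hE.2)
  · exact h1.originAndPair_swap (h2 (h4 hE.1)) (h4 hE.1)

theorem ContinuousFamily.antiPitchforkAt (hk : ContinuousFamily k) (hEc : 0 < Ec)
    (ha : (k Ec).F1 + (k Ec).G0 = 0)
    (hb : 0 < σ * ((k Ec).F1 - (k Ec).G0)) (hq : 0 < σ * ((k Ec).F2 + (k Ec).G1))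
    (hsign : ∀ᶠ E in 𝓝 Ec, (E < Ec → σ * ((k E).F1 + (k E).G0) < 0) ∧
      (Ec < E → 0 < σ * ((k E).F1 + (k E).G0))) :
    AntiPitchforkAt (fun E => (k E).eval) 1 0 Ec ∧
      AntiPitchforkAt (fun E => (k E).swap.eval) 0 1 Ec := by
  obtain ⟨r, hr, hrE, s, hs, hev⟩ := hk.exists_branch hEc ha hb hq
  obtain ⟨η, hη, hηE, h⟩ := exists_halfwidth hEc (hev.and hsign)
  refine ⟨⟨η, hη, r, hr, by linarith, s, fun E hE => ?_, fun E hE => ?_,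
    hs.mono_left nhdsWithin_le_nhds⟩, ⟨η, hη, r, hr, by linarith, s, fun E hE => ?_,
    fun E hE => ?_, hs.mono_left nhdsWithin_le_nhds⟩⟩
  all_goals
    obtain ⟨⟨h1, h2⟩, h3, h4⟩ := h E ⟨by linarith [hE.1], by linarith [hE.2]⟩
    try rw [mul_one, mul_zero]
  · exact h1.originAndPair (h2 (h3 hE.2)) (h3 hE.2)
  · exact h1.onlyOrigin hr (h4 hE.1)
  · exact h1.originAndPair_swap (h2 (h3 hE.2)) (h3 hE.2)
  · exact h1.onlyOrigin_swap hr (h4 hE.1)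

end Bifurcations

end EvenHam

/-! ### Heteroclinic orbits -/

/-- An autonomous scalar equation with a positive and bounded continuous right-hand side has a
global solution that runs from `-∞` to `∞`: the inverse function of `∫ dx / ρ(x)`. -/
theorem exists_global_solution {ρ : ℝ → ℝ} (hρ : Continuous ρ) (hpos : ∀ x, 0 < ρ x) {M : ℝ}
    (hM : ∀ x, ρ x ≤ M) :
    ∃ τ : ℝ → ℝ, (∀ t, HasDerivAt τ (ρ (τ t)) t) ∧ Tendsto τ atTop atTop ∧
      Tendsto τ atBot atBot := by
  have hM0 : 0 < M := (hpos 0).trans_le (hM 0)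
  have hinv : Continuous fun x => (ρ x)⁻¹ := hρ.inv₀ fun x => (hpos x).ne'
  set T : ℝ → ℝ := fun u => ∫ x in (0 : ℝ)..u, (ρ x)⁻¹ with hT
  have hTd : ∀ x, HasDerivAt T (ρ x)⁻¹ x := fun x =>
    (hinv.integral_hasStrictDerivAt 0 x).hasDerivAt
  have hmono : StrictMono T := strictMono_of_hasDerivAt_pos hTd fun x => inv_pos.2 (hpos x)
  have hslope : Monotone fun x => T x - x / M := by
    refine monotone_of_hasDerivAt_nonneg (f' := fun x => (ρ x)⁻¹ - 1 / M)
      (fun x => (hTd x).sub ((hasDerivAt_id x).div_const M)) fun x => ?_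
    have := inv_anti₀ (hpos x) (hM x)
    simp only [Pi.zero_apply, one_div, sub_nonneg]
    exact this
  have hT0 : T 0 = 0 := by simp [hT]
  have htop : Tendsto T atTop atTop := by
    refine tendsto_atTop_mono' atTop ?_ (tendsto_id.atTop_div_const hM0)
    filter_upwards [eventually_ge_atTop (0 : ℝ)] with x hx
    have := hslope hx
    simp only [hT0, zero_div, sub_zero, id] at this ⊢
    linarith
  have hbot : Tendsto T atBot atBot := by
    refine tendsto_atBot_mono' atBot ?_ (tendsto_id.atBot_div_const hM0)
    filter_upwards [eventually_le_atBot (0 : ℝ)] with x hx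
    have := hslope hx
    simp only [hT0, zero_div, sub_zero, id] at this ⊢
    linarith
  have hTc : Continuous T := continuous_iff_continuousAt.2 fun x => (hTd x).continuousAt
  let e := hmono.orderIsoOfSurjective T (hTc.surjective htop hbot)
  have he : ∀ t, T (e.symm t) = t := fun t => e.apply_symm_apply t
  refine ⟨e.symm, fun t => ?_, e.symm.tendsto_atTop, e.symm.tendsto_atBot⟩
  have := HasDerivAt.of_local_left_inverse (e.symm.continuous.continuousAt (x := t))
    (hTd (e.symm t)) (inv_ne_zero (hpos _).ne') (Eventually.of_forall he)
  rwa [inv_inv] at this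

/-- The form of the reduced Hamiltonian. Its values at the two normal modes `J = 0` and `J = E`
differ by `D E`. -/
noncomputable def reducedModel (E c D f0 f1 g0 g1 J ψ : ℝ) : ℝ :=
  c + D * J + J * (E - J) * ((f0 + f1 * J) + (g0 + g1 * J) * Real.cos (2 * ψ))

section Model

variable {E c D f0 f1 g0 g1 : ℝ}

theorem differentiable_reducedModel :
    Differentiable ℝ fun z : ℝ × ℝ => reducedModel E c D f0 f1 g0 g1 z.1 z.2 := by
  unfold reducedModel
  fun_prop

theorem reducedModel_hasDerivAt_angle (J ψ : ℝ) :
    HasDerivAt (fun s => reducedModel E c D f0 f1 g0 g1 J s)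
      (-2 * J * (E - J) * (g0 + g1 * J) * Real.sin (2 * ψ)) ψ := by
  have h2 : HasDerivAt (fun s : ℝ => 2 * s) 2 ψ := by
    simpa using (hasDerivAt_id ψ).const_mul (2 : ℝ)
  have h := ((((h2.cos).const_mul (g0 + g1 * J)).const_add (f0 + f1 * J)).const_mul
    (J * (E - J))).const_add (c + D * J)
  refine h.congr_deriv ?_
  ring

theorem reducedModel_hasDerivAt_action (J ψ : ℝ) :
    HasDerivAt (fun s => reducedModel E c D f0 f1 g0 g1 s ψ)
      (D + (E - 2 * J) * ((f0 + f1 * J) + (g0 + g1 * J) * Real.cos (2 * ψ))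
        + J * (E - J) * (f1 + g1 * Real.cos (2 * ψ))) J := by
  have i := hasDerivAt_id J
  have h := ((i.const_mul D).const_add c).add ((i.mul (i.const_sub E)).mul
    (((i.const_mul f1).const_add f0).add
      (((i.const_mul g1).const_add g0).mul_const (Real.cos (2 * ψ)))))
  refine (h.congr_deriv ?_).congr_of_eventuallyEq (Eventually.of_forall fun s => ?_)
  · simp only [Pi.add_apply, Pi.mul_apply, id]; ring
  · simp only [reducedModel, Pi.add_apply, Pi.mul_apply, id]

theorem affine_pos {a b E J : ℝ} (h0 : 0 < a) (h1 : 0 < a + b * E) (hJ0 : 0 ≤ J) (hJE : J ≤ E) :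
    0 < a + b * J := by
  rcases le_total 0 b with hb | hb
  · nlinarith [mul_nonneg hb hJ0]
  · nlinarith [mul_le_mul_of_nonpos_left hJE hb]

/-- When the two modes have the same energy, the level set through them contains the curve
`cos 2ψ = -f(J) / g(J)`, which is the graph of a function over `0 ≤ J ≤ E` as `|f| < g`. Along it,
with `J = E · sigmoid τ`, the equation for `τ` has a positive bounded right-hand side. -/
theorem exists_connection (hE : 0 < E)
    (h1 : 0 < g0 - f0) (h2 : 0 < g0 + f0) (h3 : 0 < g0 - f0 + (g1 - f1) * E)
    (h4 : 0 < g0 + f0 + (g1 + f1) * E) :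
    ∃ J ψ : ℝ → ℝ, (∀ t, 0 < J t ∧ J t < E) ∧
      SolvesOn (reducedModel E c 0 f0 f1 g0 g1) J ψ univ ∧
      Tendsto J atBot (𝓝 0) ∧ Tendsto J atTop (𝓝 E) := by
  have hm : ∀ J, 0 ≤ J → J ≤ E → f0 + f1 * J < g0 + g1 * J := fun J a b => by
    linarith [affine_pos h1 h3 a b]
  have hp : ∀ J, 0 ≤ J → J ≤ E → -(f0 + f1 * J) < g0 + g1 * J := fun J a b => by
    linarith [affine_pos h2 h4 a b]
  have hg : ∀ J, 0 ≤ J → J ≤ E → 0 < g0 + g1 * J := fun J a b => by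
    linarith [hm J a b, hp J a b]
  set q : ℝ → ℝ := fun J => -(f0 + f1 * J) / (g0 + g1 * J) with hq
  have hq1 : ∀ J, 0 ≤ J → J ≤ E → q J < 1 := fun J a b => by
    rw [hq, div_lt_one (hg J a b)]; exact hp J a b
  have hq2 : ∀ J, 0 ≤ J → J ≤ E → -1 < q J := fun J a b => by
    rw [hq, lt_div_iff₀ (hg J a b)]; linarith [hm J a b]
  have hσ0 : ∀ x, 0 ≤ E * Real.sigmoid x := fun x => mul_nonneg hE.le (Real.sigmoid_nonneg x)
  have hσE : ∀ x, E * Real.sigmoid x ≤ E := fun x =>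
    mul_le_of_le_one_right hE.le (Real.sigmoid_le_one x)
  have hσc : Continuous Real.sigmoid := differentiable_sigmoid.continuous
  set ρ : ℝ → ℝ := fun x => 2 * E * (g0 + g1 * (E * Real.sigmoid x)) *
    √(1 - q (E * Real.sigmoid x) ^ 2) with hρ
  have hsq : ∀ J, 0 ≤ J → J ≤ E → 0 < 1 - q J ^ 2 := fun J a b => by
    nlinarith [hq1 J a b, hq2 J a b]
  have hρpos : ∀ x, 0 < ρ x := fun x => by
    have a := hg _ (hσ0 x) (hσE x)
    have b := Real.sqrt_pos.2 (hsq _ (hσ0 x) (hσE x))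
    simp only [hρ]; positivity
  have hρc : Continuous ρ := by
    have hqc : Continuous fun x => q (E * Real.sigmoid x) := by
      simp only [hq]
      refine Continuous.div (by fun_prop) (by fun_prop) fun x => (hg _ (hσ0 x) (hσE x)).ne'
    exact (continuous_const.mul (by fun_prop)).mul
      (Real.continuous_sqrt.comp (continuous_const.sub (hqc.pow 2)))
  have hρM : ∀ x, ρ x ≤ 2 * E * (|g0| + |g1| * E) * 1 := fun x => by
    have a := hg _ (hσ0 x) (hσE x)
    have b : √(1 - q (E * Real.sigmoid x) ^ 2) ≤ 1 := by
      rw [Real.sqrt_le_one]; linarith [sq_nonneg (q (E * Real.sigmoid x))]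
    have d : g0 + g1 * (E * Real.sigmoid x) ≤ |g0| + |g1| * E := by
      have e1 := le_abs_self g0
      have e2 : g1 * (E * Real.sigmoid x) ≤ |g1| * E :=
        (mul_le_mul_of_nonneg_right (le_abs_self g1) (hσ0 x)).trans
          (mul_le_mul_of_nonneg_left (hσE x) (abs_nonneg g1))
      linarith
    simp only [hρ]
    gcongr
  obtain ⟨τ, hτ, htop, hbot⟩ := exists_global_solution hρc hρpos hρM
  set J : ℝ → ℝ := fun t => E * Real.sigmoid (τ t) with hJ
  set ψ : ℝ → ℝ := fun t => -(Real.arccos (q (J t)) / 2) with hψ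
  have hJ0 : ∀ t, 0 < J t := fun t => mul_pos hE (Real.sigmoid_pos _)
  have hJE : ∀ t, J t < E := fun t => mul_lt_of_lt_one_right hE (Real.sigmoid_lt_one _)
  have hcos : ∀ t, Real.cos (2 * ψ t) = q (J t) := fun t => by
    have : 2 * ψ t = -Real.arccos (q (J t)) := by simp only [hψ]; ring
    rw [this, Real.cos_neg, Real.cos_arccos (hq2 _ (hJ0 t).le (hJE t).le).le
      (hq1 _ (hJ0 t).le (hJE t).le).le]
  have hsin : ∀ t, Real.sin (2 * ψ t) = -√(1 - q (J t) ^ 2) := fun t => by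
    have : 2 * ψ t = -Real.arccos (q (J t)) := by simp only [hψ]; ring
    rw [this, Real.sin_neg, Real.sin_arccos]
  have hlevel : ∀ t, (f0 + f1 * J t) + (g0 + g1 * J t) * Real.cos (2 * ψ t) = 0 := fun t => by
    rw [hcos]
    have := (hg _ (hJ0 t).le (hJE t).le).ne'
    simp only [hq]
    rw [mul_div_cancel₀ _ this]
    ring
  have hJd : ∀ t, HasDerivAt J (-2 * J t * (E - J t) * (g0 + g1 * J t) * Real.sin (2 * ψ t)) t := by
    intro t
    have h := ((Real.hasDerivAt_sigmoid (τ t)).comp t (hτ t)).const_mul E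
    refine h.congr_deriv ?_
    rw [hsin]
    simp only [hρ, hJ]; ring
  have hψd : ∀ t, DifferentiableAt ℝ ψ t := fun t => by
    have a1 : q (J t) ≠ 1 := (hq1 _ (hJ0 t).le (hJE t).le).ne
    have a2 : q (J t) ≠ -1 := (hq2 _ (hJ0 t).le (hJE t).le).ne'
    have hne := (hg _ (hJ0 t).le (hJE t).le).ne'
    have b : DifferentiableAt ℝ (fun t => q (J t)) t := by
      have := (hJd t).differentiableAt
      simp only [hq]
      refine DifferentiableAt.div (by fun_prop) (by fun_prop) hne
    exact (((Real.hasDerivAt_arccos a2 a1).differentiableAt.comp t b).div_const 2).neg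
  refine ⟨J, ψ, fun t => ⟨hJ0 t, hJE t⟩, fun t _ => ⟨?_, ?_⟩, ?_, ?_⟩
  · rw [(reducedModel_hasDerivAt_angle _ _).deriv]
    exact (hJd t).hasDerivWithinAt
  · -- differentiate the equation of the level set along the curve and divide by `∂/∂ψ ≠ 0`
    have hψ' := (hψd t).hasDerivAt
    have h2ψ : HasDerivAt (fun t => 2 * ψ t) (2 * deriv ψ t) t := hψ'.const_mul 2
    have hz := (((hJd t).const_mul f1).const_add f0).add
      ((((hJd t).const_mul g1).const_add g0).mul h2ψ.cos)
    have hz0 := hz.unique ((hasDerivAt_const t (0 : ℝ)).congr_of_eventuallyEq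
      (Eventually.of_forall fun s => by simpa using hlevel s))
    have hsne : Real.sin (2 * ψ t) ≠ 0 := by
      rw [hsin]
      exact neg_ne_zero.2 (Real.sqrt_pos.2 (hsq _ (hJ0 t).le (hJE t).le)).ne'
    have hne : 2 * (g0 + g1 * J t) * Real.sin (2 * ψ t) ≠ 0 :=
      mul_ne_zero (mul_ne_zero two_ne_zero (hg _ (hJ0 t).le (hJE t).le).ne') hsne
    rw [(reducedModel_hasDerivAt_action _ _).deriv, hlevel]
    refine (hψ'.congr_deriv ?_).hasDerivWithinAt
    refine mul_left_cancel₀ hne ?_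
    linear_combination -hz0
  · simpa using ((Real.tendsto_sigmoid_atBot.comp hbot).const_mul E)
  · simpa using ((Real.tendsto_sigmoid_atTop.comp htop).const_mul E)

/-- The flow is reversible under `(J, ψ, t) ↦ (J, -ψ, -t)`. -/
theorem solvesOn_reverse {J ψ : ℝ → ℝ} (h : SolvesOn (reducedModel E c D f0 f1 g0 g1) J ψ univ) :
    SolvesOn (reducedModel E c D f0 f1 g0 g1) (fun t => J (-t)) (fun t => -ψ (-t)) univ := by
  intro t _
  obtain ⟨hJ, hψ⟩ := h (-t) (mem_univ _)
  rw [(reducedModel_hasDerivAt_angle _ _).deriv] at hJ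
  rw [(reducedModel_hasDerivAt_action _ _).deriv] at hψ
  have hJ' := (hJ.hasDerivAt univ_mem).comp t (hasDerivAt_neg t)
  have hψ' := ((hψ.hasDerivAt univ_mem).comp t (hasDerivAt_neg t)).neg
  rw [(reducedModel_hasDerivAt_angle _ _).deriv, (reducedModel_hasDerivAt_action _ _).deriv,
    show 2 * -ψ (-t) = -(2 * ψ (-t)) by ring, Real.sin_neg, Real.cos_neg]
  exact ⟨(hJ'.congr_deriv (by ring)).hasDerivWithinAt, (hψ'.congr_deriv (by ring)).hasDerivWithinAt⟩

theorem tendsto_reducedModel {J ψ : ℝ → ℝ} {l : Filter ℝ} {a : ℝ}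
    (ha : a * (E - a) = 0) (hJ : Tendsto J l (𝓝 a)) :
    Tendsto (fun t => reducedModel E c D f0 f1 g0 g1 (J t) (ψ t)) l (𝓝 (c + D * a)) := by
  have hprod : Tendsto (fun t => J t * (E - J t)) l (𝓝 0) := by
    rw [← ha]; exact hJ.mul (hJ.const_sub E)
  have hg : Tendsto (fun t => J t * (E - J t) * (g0 + g1 * J t)) l (𝓝 0) := by
    have := hprod.mul ((hJ.const_mul g1).const_add g0)
    rwa [zero_mul] at this
  have hgc : Tendsto (fun t => J t * (E - J t) * (g0 + g1 * J t) * Real.cos (2 * ψ t)) l (𝓝 0) := by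
    refine squeeze_zero_norm (fun t => ?_) (tendsto_norm_zero.comp hg)
    rw [norm_mul]
    exact mul_le_of_le_one_right (norm_nonneg _) (Real.abs_cos_le_one _)
  have hf : Tendsto (fun t => J t * (E - J t) * (f0 + f1 * J t)) l (𝓝 0) := by
    have := hprod.mul ((hJ.const_mul f1).const_add f0)
    rwa [zero_mul] at this
  have h := (((hJ.const_mul D).const_add c).add hf).add hgc
  rw [add_zero, add_zero] at h
  refine h.congr fun t => ?_
  unfold reducedModel; ring

/-- An orbit joining the two modes forces their energies to agree. -/
theorem energy_eq_of_connection {J ψ : ℝ → ℝ} {a b : ℝ}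
    (h : SolvesOn (reducedModel E c D f0 f1 g0 g1) J ψ univ)
    (ha : a * (E - a) = 0) (hb : b * (E - b) = 0) (hab : a ≠ b)
    (hJa : Tendsto J atBot (𝓝 a)) (hJb : Tendsto J atTop (𝓝 b)) : D = 0 := by
  have hconst : (fun t => reducedModel E c D f0 f1 g0 g1 (J t) (ψ t))
      = fun _ => reducedModel E c D f0 f1 g0 g1 (J 0) (ψ 0) := by
    funext t; exact h.energy_univ differentiable_reducedModel t 0
  have e1 := tendsto_reducedModel (c := c) (D := D) (f0 := f0) (f1 := f1) (g0 := g0) (g1 := g1)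
    (ψ := ψ) ha hJa
  have e2 := tendsto_reducedModel (c := c) (D := D) (f0 := f0) (f1 := f1) (g0 := g0) (g1 := g1)
    (ψ := ψ) hb hJb
  rw [hconst] at e1 e2
  have e3 := tendsto_nhds_unique e1 tendsto_const_nhds
  have e4 := tendsto_nhds_unique e2 tendsto_const_nhds
  have : D * (a - b) = 0 := by linarith
  exact (mul_eq_zero.1 this).resolve_right (sub_ne_zero.2 hab)

end Model

/-! ### Roots of the bifurcation equations -/

/-- A root `Ec` of `δ + s E + p δ E + κ E²` with positive `E`-derivative is a sign change. -/
theorem eventually_sign {δ s p κ Ec : ℝ} (h0 : δ + s * Ec + p * δ * Ec + κ * Ec ^ 2 = 0)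
    (h1 : 0 < s + p * δ + 2 * κ * Ec) :
    ∀ᶠ E in 𝓝 Ec, (E < Ec → δ + s * E + p * δ * E + κ * E ^ 2 < 0) ∧
      (Ec < E → 0 < δ + s * E + p * δ * E + κ * E ^ 2) := by
  have hev : ∀ᶠ E in 𝓝 Ec, 0 < s + p * δ + κ * (E + Ec) := by
    refine ContinuousAt.eventually_lt continuousAt_const (by fun_prop) ?_
    linarith
  filter_upwards [hev] with E hE
  have e : δ + s * E + p * δ * E + κ * E ^ 2 = (E - Ec) * (s + p * δ + κ * (E + Ec)) := by
    linear_combination h0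
  rw [e]
  exact ⟨fun h => mul_neg_of_neg_of_pos (by linarith) hE, fun h => mul_pos (by linarith) hE⟩

/-- For small `δ < 0` the equation `δ + s E + p δ E + κ E² = 0` has a root
`E = -δ / s + (p / s² - κ / s³) δ² + O(δ³)`. -/
theorem exists_root (s p κ : ℝ) (hs : 0 < s) :
    ∃ e : ℝ → ℝ, Tendsto e (𝓝[<] 0) (𝓝 0) ∧ ∃ M > 0, ∀ᶠ δ in 𝓝[<] 0,
      0 < e δ ∧ δ + s * e δ + p * δ * e δ + κ * e δ ^ 2 = 0 ∧
      |e δ - -δ / s| ≤ M * δ ^ 2 ∧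
      |e δ - (-δ / s + (p / s ^ 2 - κ / s ^ 3) * δ ^ 2)| ≤ M * |δ| ^ 3 := by
  classical
  let P : ℝ → ℝ → Prop := fun δ E => E ∈ Icc (-δ / (2 * s)) (-2 * δ / s) ∧
    δ + s * E + p * δ * E + κ * E ^ 2 = 0
  have hex : ∀ᶠ δ in 𝓝[<] (0 : ℝ), ∃ E, P δ E := by
    -- the values at the ends of the interval are `δ (1/2 + O(δ))` and `-δ (1 + O(δ))`
    have c1 : ∀ᶠ δ in 𝓝[<] (0 : ℝ), 0 < 1 / 2 - p * δ / (2 * s) + κ * δ / (2 * s) ^ 2 := by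
      refine ContinuousAt.eventually_lt continuousAt_const
        (g := fun δ : ℝ => 1 / 2 - p * δ / (2 * s) + κ * δ / (2 * s) ^ 2)
        (by fun_prop) (by simp) |>.filter_mono nhdsWithin_le_nhds
    have c2 : ∀ᶠ δ in 𝓝[<] (0 : ℝ), 0 < 1 + 2 * p * δ / s - 4 * κ * δ / s ^ 2 := by
      refine ContinuousAt.eventually_lt continuousAt_const
        (g := fun δ : ℝ => 1 + 2 * p * δ / s - 4 * κ * δ / s ^ 2)
        (by fun_prop) (by simp) |>.filter_mono nhdsWithin_le_nhds
    filter_upwards [c1, c2, self_mem_nhdsWithin] with δ h1 h2 hδ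
    have hδ' : 0 < -δ := neg_pos.2 hδ
    have hcont : ContinuousOn (fun E => δ + s * E + p * δ * E + κ * E ^ 2)
        (Icc (-δ / (2 * s)) (-2 * δ / s)) := by fun_prop
    have hle : -δ / (2 * s) ≤ -2 * δ / s := by
      rw [div_le_div_iff₀ (by positivity) hs]; nlinarith [mul_pos hδ' hs]
    obtain ⟨E, hE, hE0⟩ := intermediate_value_Icc hle hcont (show (0 : ℝ) ∈ Icc _ _ from by
      constructor
      · have e1 : δ + s * (-δ / (2 * s)) + p * δ * (-δ / (2 * s)) + κ * (-δ / (2 * s)) ^ 2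
            = -((-δ) * (1 / 2 - p * δ / (2 * s) + κ * δ / (2 * s) ^ 2)) := by
          field_simp; ring
        simp only [e1]
        linarith [mul_pos hδ' h1]
      · have e2 : δ + s * (-2 * δ / s) + p * δ * (-2 * δ / s) + κ * (-2 * δ / s) ^ 2
            = (-δ) * (1 + 2 * p * δ / s - 4 * κ * δ / s ^ 2) := by
          field_simp; ring
        simp only [e2]
        exact (mul_pos hδ' h2).le)
    exact ⟨E, hE, hE0⟩
  let e : ℝ → ℝ := fun δ => if h : ∃ E, P δ E then h.choose else 0
  have he : ∀ᶠ δ in 𝓝[<] (0 : ℝ), P δ (e δ) := by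
    filter_upwards [hex] with δ h
    simp only [e, dif_pos h]; exact h.choose_spec
  -- `M₁`, `M₂` bound the errors of the approximations of first and second order
  set M₁ := (|p| * (2 / s) + |κ| * (2 / s) ^ 2) / s with hM₁
  set M₂ := (|p| + |κ| * (3 / s)) * M₁ / s with hM₂
  have hM₁0 : 0 ≤ M₁ := by positivity
  have hM₂0 : 0 ≤ M₂ := by positivity
  refine ⟨e, ?_, M₁ + M₂ + 1, by positivity, ?_⟩
  · have h1 : Tendsto (fun δ : ℝ => -2 * δ / s) (𝓝[<] 0) (𝓝 0) := by
      have : Continuous fun δ : ℝ => -2 * δ / s := by fun_prop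
      simpa using (this.tendsto 0).mono_left nhdsWithin_le_nhds
    refine tendsto_of_tendsto_of_tendsto_of_le_of_le' tendsto_const_nhds h1 ?_ ?_
    · filter_upwards [he, self_mem_nhdsWithin] with δ h hδ
      exact (div_nonneg (neg_nonneg.2 (le_of_lt hδ)) (by positivity)).trans h.1.1
    · filter_upwards [he] with δ h using h.1.2
  · filter_upwards [he, self_mem_nhdsWithin] with δ h hδ
    obtain ⟨⟨hl, hu⟩, h0⟩ := h
    have hδ' : 0 < -δ := neg_pos.2 hδ
    have hpos : 0 < e δ := (div_pos hδ' (by positivity)).trans_le hl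
    have habs : |δ| = -δ := abs_of_neg hδ
    set x := e δ with hx
    have hxu : |x| ≤ 2 / s * |δ| := by
      rw [abs_of_pos hpos, habs]; refine hu.trans_eq ?_; ring
    have e1 : x - -δ / s = -(p * δ * x + κ * x ^ 2) / s := by
      field_simp; linear_combination h0
    have b1 : |x - -δ / s| ≤ M₁ * δ ^ 2 := by
      rw [e1, abs_div, abs_neg, abs_of_pos hs, hM₁, div_mul_eq_mul_div]
      refine div_le_div_of_nonneg_right ?_ hs.le
      calc |p * δ * x + κ * x ^ 2| ≤ |p| * |δ| * |x| + |κ| * |x| ^ 2 := by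
            refine (abs_add_le _ _).trans_eq ?_
            rw [abs_mul, abs_mul, abs_mul, abs_pow]
        _ ≤ |p| * |δ| * (2 / s * |δ|) + |κ| * (2 / s * |δ|) ^ 2 := by gcongr
        _ = (|p| * (2 / s) + |κ| * (2 / s) ^ 2) * |δ| ^ 2 := by ring
        _ = _ := by rw [sq_abs]
    have e2 : x - (-δ / s + (p / s ^ 2 - κ / s ^ 3) * δ ^ 2)
        = -((p * δ + κ * (x + -δ / s)) * (x - -δ / s)) / s := by
      have : x - (-δ / s + (p / s ^ 2 - κ / s ^ 3) * δ ^ 2)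
          = (x - -δ / s) - (p / s ^ 2 - κ / s ^ 3) * δ ^ 2 := by ring
      rw [this]
      nth_rewrite 1 [e1]
      field_simp; ring
    have b2 : |x - (-δ / s + (p / s ^ 2 - κ / s ^ 3) * δ ^ 2)| ≤ M₂ * |δ| ^ 3 := by
      rw [e2, abs_div, abs_neg, abs_of_pos hs, hM₂, div_mul_eq_mul_div, abs_mul]
      refine div_le_div_of_nonneg_right ?_ hs.le
      have hd : |-δ / s| = 1 / s * |δ| := by
        rw [abs_div, abs_neg, abs_of_pos hs]; ring
      calc |p * δ + κ * (x + -δ / s)| * |x - -δ / s|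
          ≤ (|p| * |δ| + |κ| * (2 / s * |δ| + 1 / s * |δ|)) * (M₁ * δ ^ 2) := by
            refine mul_le_mul ?_ b1 (abs_nonneg _) (by positivity)
            refine (abs_add_le _ _).trans ?_
            rw [abs_mul, abs_mul]
            gcongr
            refine (abs_add_le _ _).trans ?_
            rw [hd]
            gcongr
        _ = (|p| + |κ| * (3 / s)) * M₁ * |δ| ^ 3 := by rw [← sq_abs δ]; ring
    refine ⟨hpos, h0, b1.trans ?_, b2.trans ?_⟩
    · nlinarith [sq_nonneg δ]
    · have : 0 ≤ |δ| ^ 3 := by positivity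
      nlinarith

/-! ### The normal form in the degenerate case -/

/-- The normal form with a formal parameter in front of the fourth order term: `τ = 0` and `τ = 1`
are the truncations of order one and two. -/
noncomputable def nf (τ : ℝ) (v : Coeffs) (δ J₁ J₂ w : ℝ) : ℝ :=
  J₁ + J₂ + K2 v δ J₁ J₂ w + τ * K4 v δ J₁ J₂ w

theorem nf_zero (v : Coeffs) : nf 0 v = normalForm₁ v := by
  funext δ J₁ J₂ w; simp only [nf, normalForm₁]; ring

theorem nf_one (v : Coeffs) : nf 1 v = normalForm₂ v := by
  funext δ J₁ J₂ w; simp only [nf, normalForm₂]; ring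

namespace Coeffs

/-- The coefficient of `J₁³` in `K4`. -/
noncomputable def m30 (v : Coeffs) : ℝ := 1 / 4 * (10 * v.v60 - 17 * v.v40 ^ 2)
/-- The coefficient of `J₂³` in `K4`. -/
noncomputable def m03 (v : Coeffs) : ℝ := 1 / 4 * (10 * v.v06 - 17 * v.v04 ^ 2)
/-- The coefficient of `J₁² J₂` in `K4`. -/
noncomputable def m21 (v : Coeffs) : ℝ :=
  1 / 4 * (6 * v.v42 - 9 / 4 * v.v22 ^ 2 - 12 * v.v22 * v.v40)
/-- The coefficient of `J₁ J₂²` in `K4`. -/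
noncomputable def m12 (v : Coeffs) : ℝ :=
  1 / 4 * (6 * v.v24 - 9 / 4 * v.v22 ^ 2 - 12 * v.v22 * v.v04)
/-- The coefficient of `J₁ w` in `K4`. -/
noncomputable def n1 (v : Coeffs) : ℝ :=
  1 / 4 * (4 * v.v42 - 2 * v.v22 ^ 2 - 5 * v.v22 * v.v40)
/-- The coefficient of `J₂ w` in `K4`. -/
noncomputable def n2 (v : Coeffs) : ℝ :=
  1 / 4 * (4 * v.v24 - 2 * v.v22 ^ 2 - 5 * v.v22 * v.v04)

end Coeffs

/-- The energy of the normal mode `J₁ = 0`. -/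
noncomputable def modeEnergy (τ : ℝ) (v : Coeffs) (E : ℝ) : ℝ :=
  E + 3 / 2 * v.v04 * E ^ 2 + τ * v.m03 * E ^ 3

/-- The difference of the energies of the two normal modes, divided by `E`. -/
noncomputable def gap (τ : ℝ) (v : Coeffs) (δ E : ℝ) : ℝ :=
  δ + 2 * v.B * E + τ * (-3 * v.v40 * δ * E + (v.m30 - v.m03) * E ^ 2)

/-- The coefficient of `J (E - J)` in the reduced Hamiltonian at `J = 0`. It has no term of order
zero since `A = 2 C`. -/
noncomputable def f₀ (τ : ℝ) (v : Coeffs) (δ E : ℝ) : ℝ :=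
  τ * (δ * (3 * v.v40 - v.v22) + (v.m12 - v.m30 - 2 * v.m03) * E)

/-- The coefficient of `J² (E - J)` in the reduced Hamiltonian. -/
noncomputable def f₁ (τ : ℝ) (v : Coeffs) : ℝ := τ * (v.m03 - v.m30 + v.m21 - v.m12)

/-- The coefficient of `J (E - J) cos 2ψ` in the reduced Hamiltonian at `J = 0`. -/
noncomputable def g₀ (τ : ℝ) (v : Coeffs) (δ E : ℝ) : ℝ :=
  4 * v.C + τ * (-4 * v.C * δ + v.n2 * E)

/-- The coefficient of `J² (E - J) cos 2ψ` in the reduced Hamiltonian. -/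
noncomputable def g₁ (τ : ℝ) (v : Coeffs) : ℝ := τ * (v.n1 - v.n2)

/-- The planar Hamiltonian `c + Dρ + (E - ρ) (ρ (f0 + f1 ρ) + d (g0 + g1 ρ))`. -/
def modeHam (E c D f0 f1 g0 g1 : ℝ) : EvenHam :=
  ⟨c, D + E * f0, -f0 + E * f1, -f1, E * g0, -g0 + E * g1, -g1⟩

/-- The Hamiltonian at the mode `J₁ = 0` for `ε = 1`; the axes are exchanged for `ε = -1`. -/
noncomputable def mode₁ (ε τ : ℝ) (v : Coeffs) (δ E : ℝ) : EvenHam :=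
  modeHam E (modeEnergy τ v E) (gap τ v δ E) (f₀ τ v δ E) (f₁ τ v) (ε * g₀ τ v δ E) (ε * g₁ τ v)

/-- The Hamiltonian at the mode `J₂ = 0` for `ε = 1`; the axes are exchanged for `ε = -1`. -/
noncomputable def mode₂ (ε τ : ℝ) (v : Coeffs) (δ E : ℝ) : EvenHam :=
  modeHam E (modeEnergy τ v E + gap τ v δ E * E) (-gap τ v δ E) (f₀ τ v δ E + f₁ τ v * E)
    (-f₁ τ v) (ε * (g₀ τ v δ E + g₁ τ v * E)) (-(ε * g₁ τ v))

section Degenerate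

variable {v : Coeffs}

theorem v04_eq (hA : v.A = 2 * v.C) : v.v04 = (8 * v.C - 2 * v.B) / 3 := by
  simp only [Coeffs.A, Coeffs.B, Coeffs.C] at *; linarith

theorem v40_eq (hA : v.A = 2 * v.C) : v.v40 = (8 * v.C + 2 * v.B) / 3 := by
  simp only [Coeffs.A, Coeffs.B, Coeffs.C] at *; linarith

theorem v22_eq (v : Coeffs) : v.v22 = 8 * v.C := by
  simp only [Coeffs.C]; ring

theorem reduced_nf (hA : v.A = 2 * v.C) (τ δ E : ℝ) :
    reduced (nf τ v δ) E = reducedModel E (modeEnergy τ v E) (gap τ v δ E) (f₀ τ v δ E) (f₁ τ v)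
      (g₀ τ v δ E) (g₁ τ v) := by
  funext J ψ
  simp only [reduced, nf, K2, K4, reducedModel, modeEnergy, gap, f₀, f₁, g₀, g₁, Coeffs.m30,
    Coeffs.m03, Coeffs.m21, Coeffs.m12, Coeffs.n1, Coeffs.n2]
  rw [v04_eq hA, v40_eq hA, v22_eq]
  ring

theorem chart₁_nf (hA : v.A = 2 * v.C) (τ δ E : ℝ) :
    chart₁ (nf τ v δ) E = (mode₁ 1 τ v δ E).eval := by
  funext x y
  simp only [chart₁, nf, K2, K4, mode₁, modeHam, EvenHam.eval, EvenHam.poly, modeEnergy, gap, f₀,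
    f₁, g₀, g₁, Coeffs.m30, Coeffs.m03, Coeffs.m21, Coeffs.m12, Coeffs.n1, Coeffs.n2]
  rw [v04_eq hA, v40_eq hA, v22_eq]
  ring

theorem chart₂_nf (hA : v.A = 2 * v.C) (τ δ E : ℝ) :
    chart₂ (nf τ v δ) E = (mode₂ 1 τ v δ E).eval := by
  funext x y
  simp only [chart₂, nf, K2, K4, mode₂, modeHam, EvenHam.eval, EvenHam.poly, modeEnergy, gap, f₀,
    f₁, g₀, g₁, Coeffs.m30, Coeffs.m03, Coeffs.m21, Coeffs.m12, Coeffs.n1, Coeffs.n2]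
  rw [v04_eq hA, v40_eq hA, v22_eq]
  ring

/-- Exchanging the axes changes the sign of `cos 2ψ`. -/
theorem mode₁_swap (τ δ E : ℝ) : (mode₁ (-1) τ v δ E).swap = mode₁ 1 τ v δ E := by
  simp only [mode₁, modeHam, EvenHam.swap, EvenHam.mk.injEq, true_and]
  refine ⟨?_, ?_, ?_⟩ <;> ring

theorem mode₂_swap (τ δ E : ℝ) : (mode₂ (-1) τ v δ E).swap = mode₂ 1 τ v δ E := by
  simp only [mode₂, modeHam, EvenHam.swap, EvenHam.mk.injEq, true_and]
  refine ⟨?_, ?_, ?_⟩ <;> ring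

theorem continuousFamily_mode₁ (ε τ : ℝ) (v : Coeffs) (δ : ℝ) :
    EvenHam.ContinuousFamily (mode₁ ε τ v δ) := by
  constructor <;> simp only [mode₁, modeHam, gap, f₀, g₀] <;> fun_prop

theorem continuousFamily_mode₂ (ε τ : ℝ) (v : Coeffs) (δ : ℝ) :
    EvenHam.ContinuousFamily (mode₂ ε τ v δ) := by
  constructor <;> simp only [mode₂, modeHam, gap, f₀, g₀] <;> fun_prop

/-! ### Bifurcations of the normal form at roots of quadratic equations -/

/-- The coefficient of `δ E` in the bifurcation equations at the mode `J₁ = 0`. -/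
noncomputable def p₁ (ε τ : ℝ) (v : Coeffs) : ℝ := -τ * (8 + 4 * ε) * v.C
/-- The coefficient of `E²` in the bifurcation equations at the mode `J₁ = 0`. -/
noncomputable def κ₁ (ε τ : ℝ) (v : Coeffs) : ℝ := τ * (-3 * v.m03 + v.m12 + ε * v.n2)
/-- The coefficient of `δ E` in the bifurcation equations at the mode `J₂ = 0`. -/
noncomputable def p₂ (ε τ : ℝ) (v : Coeffs) : ℝ := τ * (-6 * v.v40 + (8 + 4 * ε) * v.C)
/-- The coefficient of `E²` in the bifurcation equations at the mode `J₂ = 0`. -/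
noncomputable def κ₂ (ε τ : ℝ) (v : Coeffs) : ℝ := τ * (3 * v.m30 - v.m21 - ε * v.n1)

/-- The bifurcation equation: the second `x`-derivative at the mode `J₁ = 0` is quadratic in `E`. -/
theorem mode₁_a (ε τ δ E : ℝ) : (mode₁ ε τ v δ E).F1 + (mode₁ ε τ v δ E).G0
    = δ + (2 * v.B + 4 * ε * v.C) * E + p₁ ε τ v * δ * E + κ₁ ε τ v * E ^ 2 := by
  simp only [mode₁, modeHam, gap, f₀, g₀, p₁, κ₁]
  rw [v22_eq]
  ring

theorem mode₂_a (ε τ δ E : ℝ) : (mode₂ ε τ v δ E).F1 + (mode₂ ε τ v δ E).G0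
    = -(δ + (2 * v.B - 4 * ε * v.C) * E + p₂ ε τ v * δ * E + κ₂ ε τ v * E ^ 2) := by
  simp only [mode₂, modeHam, gap, f₀, f₁, g₀, g₁, p₂, κ₂]
  rw [v22_eq]
  ring

/-- `E` is a nondegenerate root of the bifurcation equation at the mode `J₁ = 0`: the root is
crossed with positive slope, and the last two conditions give the other Hessian eigenvalue and the quartic
term along the axis of the bifurcation the sign of `-ε`. -/
structure Root₁ (ε τ : ℝ) (v : Coeffs) (δ E : ℝ) : Prop where
  pos : 0 < E
  root : δ + (2 * v.B + 4 * ε * v.C) * E + p₁ ε τ v * δ * E + κ₁ ε τ v * E ^ 2 = 0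
  slope : 0 < 2 * v.B + 4 * ε * v.C + p₁ ε τ v * δ + 2 * κ₁ ε τ v * E
  g_pos : 0 < g₀ τ v δ E
  quartic : 0 < ε * f₀ τ v δ E + g₀ τ v δ E - E * (ε * f₁ τ v + g₁ τ v)

/-- `E` is a nondegenerate root of the bifurcation equation at the mode `J₂ = 0`, in the same sense
as for `Root₁`. -/
structure Root₂ (ε τ : ℝ) (v : Coeffs) (δ E : ℝ) : Prop where
  pos : 0 < E
  root : δ + (2 * v.B - 4 * ε * v.C) * E + p₂ ε τ v * δ * E + κ₂ ε τ v * E ^ 2 = 0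
  slope : 0 < 2 * v.B - 4 * ε * v.C + p₂ ε τ v * δ + 2 * κ₂ ε τ v * E
  g_pos : 0 < g₀ τ v δ E + g₁ τ v * E
  quartic : 0 < ε * f₀ τ v δ E + g₀ τ v δ E + 2 * E * (ε * f₁ τ v + g₁ τ v)

section Roots

variable {ε τ δ E : ℝ}

theorem Root₁.a_eq_zero (h : Root₁ ε τ v δ E) :
    (mode₁ ε τ v δ E).F1 + (mode₁ ε τ v δ E).G0 = 0 := by
  rw [mode₁_a, h.root]

theorem Root₂.a_eq_zero (h : Root₂ ε τ v δ E) :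
    (mode₂ ε τ v δ E).F1 + (mode₂ ε τ v δ E).G0 = 0 := by
  rw [mode₂_a, h.root, neg_zero]

theorem Root₁.b_pos (hε : ε ^ 2 = 1) (h : Root₁ ε τ v δ E) :
    0 < -ε * ((mode₁ ε τ v δ E).F1 - (mode₁ ε τ v δ E).G0) := by
  have e : -ε * ((mode₁ ε τ v δ E).F1 - (mode₁ ε τ v δ E).G0) = 2 * E * g₀ τ v δ E := by
    have h1 := h.a_eq_zero
    simp only [mode₁, modeHam] at h1 ⊢
    linear_combination -ε * h1 + 2 * E * g₀ τ v δ E * hε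
  rw [e]
  exact mul_pos (mul_pos two_pos h.pos) h.g_pos

theorem Root₂.b_pos (hε : ε ^ 2 = 1) (h : Root₂ ε τ v δ E) :
    0 < -ε * ((mode₂ ε τ v δ E).F1 - (mode₂ ε τ v δ E).G0) := by
  have e : -ε * ((mode₂ ε τ v δ E).F1 - (mode₂ ε τ v δ E).G0)
      = 2 * E * (g₀ τ v δ E + g₁ τ v * E) := by
    have h1 := h.a_eq_zero
    simp only [mode₂, modeHam] at h1 ⊢
    linear_combination -ε * h1 + 2 * E * (g₀ τ v δ E + g₁ τ v * E) * hε
  rw [e]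
  exact mul_pos (mul_pos two_pos h.pos) h.g_pos

theorem Root₁.q_pos (hε : ε ^ 2 = 1) (h : Root₁ ε τ v δ E) :
    0 < -ε * ((mode₁ ε τ v δ E).F2 + (mode₁ ε τ v δ E).G1) := by
  refine h.quartic.trans_eq ?_
  simp only [mode₁, modeHam]
  linear_combination (-g₀ τ v δ E + E * g₁ τ v) * hε

theorem Root₂.q_pos (hε : ε ^ 2 = 1) (h : Root₂ ε τ v δ E) :
    0 < -ε * ((mode₂ ε τ v δ E).F2 + (mode₂ ε τ v δ E).G1) := by
  refine h.quartic.trans_eq ?_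
  simp only [mode₂, modeHam]
  linear_combination (-g₀ τ v δ E - 2 * E * g₁ τ v) * hε

theorem Root₁.pitchfork (hA : v.A = 2 * v.C) (h : Root₁ 1 τ v δ E) :
    Pitchfork1I (nf τ v δ) E := by
  have hk := (continuousFamily_mode₁ 1 τ v δ).pitchforkAt h.pos h.a_eq_zero
    (h.b_pos (by norm_num)) (h.q_pos (by norm_num)) ?_
  · have e : chart₁ (nf τ v δ) = fun E => (mode₁ 1 τ v δ E).eval := by
      funext E; exact chart₁_nf hA τ δ E
    rw [Pitchfork1I, e]
    exact hk.1
  · filter_upwards [eventually_sign h.root h.slope] with x hx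
    rw [mode₁_a]
    exact ⟨fun h1 => by linarith [hx.1 h1], fun h1 => by linarith [hx.2 h1]⟩

theorem Root₁.antiPitchfork (hA : v.A = 2 * v.C) (h : Root₁ (-1) τ v δ E) :
    AntiPitchfork1L (nf τ v δ) E := by
  have hk := (continuousFamily_mode₁ (-1) τ v δ).antiPitchforkAt h.pos h.a_eq_zero
    (h.b_pos (by norm_num)) (h.q_pos (by norm_num)) ?_
  · have e : chart₁ (nf τ v δ) = fun E => (mode₁ (-1) τ v δ E).swap.eval := by
      funext E; rw [mode₁_swap]; exact chart₁_nf hA τ δ E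
    rw [AntiPitchfork1L, e]
    exact hk.2
  · filter_upwards [eventually_sign h.root h.slope] with x hx
    rw [mode₁_a]
    exact ⟨fun h1 => by linarith [hx.1 h1], fun h1 => by linarith [hx.2 h1]⟩

theorem Root₂.pitchfork (hA : v.A = 2 * v.C) (h : Root₂ (-1) τ v δ E) :
    Pitchfork2L (nf τ v δ) E := by
  have hk := (continuousFamily_mode₂ (-1) τ v δ).pitchforkAt h.pos h.a_eq_zero
    (h.b_pos (by norm_num)) (h.q_pos (by norm_num)) ?_
  · have e : chart₂ (nf τ v δ) = fun E => (mode₂ (-1) τ v δ E).swap.eval := by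
      funext E; rw [mode₂_swap]; exact chart₂_nf hA τ δ E
    rw [Pitchfork2L, e]
    exact hk.2
  · filter_upwards [eventually_sign h.root h.slope] with x hx
    rw [mode₂_a]
    exact ⟨fun h1 => by linarith [hx.1 h1], fun h1 => by linarith [hx.2 h1]⟩

theorem Root₂.antiPitchfork (hA : v.A = 2 * v.C) (h : Root₂ 1 τ v δ E) :
    AntiPitchfork2I (nf τ v δ) E := by
  have hk := (continuousFamily_mode₂ 1 τ v δ).antiPitchforkAt h.pos h.a_eq_zero
    (h.b_pos (by norm_num)) (h.q_pos (by norm_num)) ?_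
  · have e : chart₂ (nf τ v δ) = fun E => (mode₂ 1 τ v δ E).eval := by
      funext E; exact chart₂_nf hA τ δ E
    rw [AntiPitchfork2I, e]
    exact hk.1
  · filter_upwards [eventually_sign h.root h.slope] with x hx
    rw [mode₂_a]
    exact ⟨fun h1 => by linarith [hx.1 h1], fun h1 => by linarith [hx.2 h1]⟩

end Roots

theorem gap_eq (τ δ E : ℝ) : gap τ v δ E
    = δ + 2 * v.B * E + -3 * τ * v.v40 * δ * E + τ * (v.m30 - v.m03) * E ^ 2 := by
  simp only [gap]; ring

/-- `E` is a nondegenerate root of the equation of equal energies of the two normal modes, at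
which `|f| < g` at both ends of the interval of the actions. -/
structure GapRoot (τ : ℝ) (v : Coeffs) (δ E : ℝ) : Prop where
  pos : 0 < E
  root : δ + 2 * v.B * E + -3 * τ * v.v40 * δ * E + τ * (v.m30 - v.m03) * E ^ 2 = 0
  slope : 0 < 2 * v.B + -3 * τ * v.v40 * δ + 2 * (τ * (v.m30 - v.m03)) * E
  left_sub : 0 < g₀ τ v δ E - f₀ τ v δ E
  left_add : 0 < g₀ τ v δ E + f₀ τ v δ E
  right_sub : 0 < g₀ τ v δ E - f₀ τ v δ E + (g₁ τ v - f₁ τ v) * E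
  right_add : 0 < g₀ τ v δ E + f₀ τ v δ E + (g₁ τ v + f₁ τ v) * E

theorem GapRoot.hessDet_neg₁ {τ δ E : ℝ} (h : GapRoot τ v δ E) :
    hessDet (mode₁ 1 τ v δ E).eval 0 0 < 0 := by
  rw [EvenHam.hessDet_origin]
  have h0 : gap τ v δ E = 0 := by rw [gap_eq, h.root]
  simp only [mode₁, modeHam, h0]
  have := mul_pos (mul_pos h.pos h.pos) (mul_pos h.left_sub h.left_add)
  linarith

theorem GapRoot.hessDet_neg₂ {τ δ E : ℝ} (h : GapRoot τ v δ E) :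
    hessDet (mode₂ 1 τ v δ E).eval 0 0 < 0 := by
  rw [EvenHam.hessDet_origin]
  have h0 : gap τ v δ E = 0 := by rw [gap_eq, h.root]
  simp only [mode₂, modeHam, h0]
  have := mul_pos (mul_pos h.pos h.pos) (mul_pos h.right_sub h.right_add)
  linarith

theorem continuous_hessDet_origin {k : ℝ → EvenHam} (hk : EvenHam.ContinuousFamily k) :
    Continuous fun E => hessDet (k E).eval 0 0 := by
  simp only [EvenHam.hessDet_origin]
  exact (hk.F1.add hk.G0).mul (hk.F1.sub hk.G0)

/-- Close to a root of the gap the energies of the modes agree only at the root itself, so that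
connections exist there and nowhere else. -/
theorem GapRoot.globalBifurcation (hA : v.A = 2 * v.C) {τ δ E : ℝ} (h : GapRoot τ v δ E) :
    GlobalBifurcationAt (nf τ v δ) E := by
  have ev1 := ((continuous_hessDet_origin (continuousFamily_mode₁ 1 τ v δ)).continuousAt
    (x := E)).eventually_lt continuousAt_const h.hessDet_neg₁
  have ev2 := ((continuous_hessDet_origin (continuousFamily_mode₂ 1 τ v δ)).continuousAt
    (x := E)).eventually_lt continuousAt_const h.hessDet_neg₂
  have ev3 := eventually_sign h.root h.slope
  obtain ⟨η, hη, hηE, hall⟩ := EvenHam.exists_halfwidth h.pos (ev1.and (ev2.and ev3))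
  have h0 : gap τ v δ E = 0 := by rw [gap_eq, h.root]
  have hpos := h.pos
  obtain ⟨J, ψ, c1, c2, c3, c4⟩ := exists_connection (c := modeEnergy τ v E) h.pos h.left_sub
    h.left_add h.right_sub h.right_add
  refine ⟨η, hη, by linarith, fun x hx => ?_, ⟨J, ψ, c1, ?_, c3, c4⟩,
    ⟨fun t => J (-t), fun t => -ψ (-t), fun t => c1 (-t), ?_, c4.comp tendsto_neg_atBot_atTop,
      c3.comp tendsto_neg_atTop_atBot⟩, fun x hx hne => ?_⟩
  · obtain ⟨d1, d2, -⟩ := hall x hx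
    rw [chart₁_nf hA, chart₂_nf hA]
    exact ⟨⟨EvenHam.origin_isEquilibrium _, d1⟩, ⟨EvenHam.origin_isEquilibrium _, d2⟩⟩
  · rw [reduced_nf hA, h0]; exact c2
  · rw [reduced_nf hA, h0]; exact solvesOn_reverse c2
  · obtain ⟨-, -, d3, d4⟩ := hall x hx
    have hx0 : 0 < x := by linarith [hx.1]
    have hg : gap τ v δ x ≠ 0 := by
      rw [gap_eq]
      rcases lt_or_gt_of_ne hne with h1 | h1
      · exact (d3 h1).ne
      · exact (d4 h1).ne'
    constructor
    · rintro ⟨J, ψ, -, s, a, b⟩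
      rw [reduced_nf hA] at s
      exact hg (energy_eq_of_connection s (by ring) (by ring) hx0.ne a b)
    · rintro ⟨J, ψ, -, s, a, b⟩
      rw [reduced_nf hA] at s
      exact hg (energy_eq_of_connection s (by ring) (by ring) hx0.ne' a b)

/-! ### Bifurcation values for small detuning -/

theorem eventually_pos_of_tendsto {F : ℝ → ℝ → ℝ} {e : ℝ → ℝ}
    (hF : Continuous fun z : ℝ × ℝ => F z.1 z.2) (h0 : 0 < F 0 0)
    (he : Tendsto e (𝓝[<] 0) (𝓝 0)) : ∀ᶠ δ in 𝓝[<] (0 : ℝ), 0 < F δ (e δ) := by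
  have h1 : Tendsto (fun δ : ℝ => (δ, e δ)) (𝓝[<] 0) (𝓝 (0, 0)) :=
    (tendsto_id.mono_left nhdsWithin_le_nhds).prodMk_nhds he
  exact ((hF.tendsto (0, 0)).comp h1).eventually (lt_mem_nhds h0)

theorem exists_root₁ {ε τ : ℝ} (hC : 0 < v.C) (hs : 0 < 2 * v.B + 4 * ε * v.C) :
    ∃ e : ℝ → ℝ, ∃ M > 0, ∀ᶠ δ in 𝓝[<] 0, Root₁ ε τ v δ (e δ) ∧
      |e δ - -δ / (2 * v.B + 4 * ε * v.C)| ≤ M * δ ^ 2 ∧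
      |e δ - (-δ / (2 * v.B + 4 * ε * v.C) + (p₁ ε τ v / (2 * v.B + 4 * ε * v.C) ^ 2
        - κ₁ ε τ v / (2 * v.B + 4 * ε * v.C) ^ 3) * δ ^ 2)| ≤ M * |δ| ^ 3 := by
  obtain ⟨e, he, M, hM, hev⟩ := exists_root _ (p₁ ε τ v) (κ₁ ε τ v) hs
  refine ⟨e, M, hM, ?_⟩
  have w1 := eventually_pos_of_tendsto
    (F := fun δ E => 2 * v.B + 4 * ε * v.C + p₁ ε τ v * δ + 2 * κ₁ ε τ v * E)
    (by fun_prop) (by simpa using hs) he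
  have w2 := eventually_pos_of_tendsto (F := fun δ E => g₀ τ v δ E)
    (by simp only [g₀]; fun_prop) (by simpa [g₀] using hC) he
  have w3 := eventually_pos_of_tendsto
    (F := fun δ E => ε * f₀ τ v δ E + g₀ τ v δ E - E * (ε * f₁ τ v + g₁ τ v))
    (by simp only [g₀, f₀]; fun_prop) (by simpa [g₀, f₀] using hC) he
  filter_upwards [hev, w1, w2, w3] with δ h h1 h2 h3
  exact ⟨⟨h.1, h.2.1, h1, h2, h3⟩, h.2.2⟩

theorem exists_root₂ {ε τ : ℝ} (hC : 0 < v.C) (hs : 0 < 2 * v.B - 4 * ε * v.C) :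
    ∃ e : ℝ → ℝ, ∃ M > 0, ∀ᶠ δ in 𝓝[<] 0, Root₂ ε τ v δ (e δ) ∧
      |e δ - -δ / (2 * v.B - 4 * ε * v.C)| ≤ M * δ ^ 2 ∧
      |e δ - (-δ / (2 * v.B - 4 * ε * v.C) + (p₂ ε τ v / (2 * v.B - 4 * ε * v.C) ^ 2
        - κ₂ ε τ v / (2 * v.B - 4 * ε * v.C) ^ 3) * δ ^ 2)| ≤ M * |δ| ^ 3 := by
  obtain ⟨e, he, M, hM, hev⟩ := exists_root _ (p₂ ε τ v) (κ₂ ε τ v) hs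
  refine ⟨e, M, hM, ?_⟩
  have w1 := eventually_pos_of_tendsto
    (F := fun δ E => 2 * v.B - 4 * ε * v.C + p₂ ε τ v * δ + 2 * κ₂ ε τ v * E)
    (by fun_prop) (by simpa using hs) he
  have w2 := eventually_pos_of_tendsto (F := fun δ E => g₀ τ v δ E + g₁ τ v * E)
    (by simp only [g₀]; fun_prop) (by simpa [g₀] using hC) he
  have w3 := eventually_pos_of_tendsto
    (F := fun δ E => ε * f₀ τ v δ E + g₀ τ v δ E + 2 * E * (ε * f₁ τ v + g₁ τ v))
    (by simp only [g₀, f₀]; fun_prop) (by simpa [g₀, f₀] using hC) he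
  filter_upwards [hev, w1, w2, w3] with δ h h1 h2 h3
  exact ⟨⟨h.1, h.2.1, h1, h2, h3⟩, h.2.2⟩

theorem exists_gapRoot {τ : ℝ} (hC : 0 < v.C) (hB : 0 < v.B) :
    ∃ e : ℝ → ℝ, ∃ M > 0, ∀ᶠ δ in 𝓝[<] 0, GapRoot τ v δ (e δ) ∧
      |e δ - -δ / (2 * v.B)| ≤ M * δ ^ 2 := by
  obtain ⟨e, he, M, hM, hev⟩ := exists_root (2 * v.B) (-3 * τ * v.v40) (τ * (v.m30 - v.m03))
    (by positivity)
  refine ⟨e, M, hM, ?_⟩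
  have w1 := eventually_pos_of_tendsto
    (F := fun δ E => 2 * v.B + -3 * τ * v.v40 * δ + 2 * (τ * (v.m30 - v.m03)) * E)
    (by fun_prop) (by simpa using hB) he
  have w2 := eventually_pos_of_tendsto (F := fun δ E => g₀ τ v δ E - f₀ τ v δ E)
    (by simp only [g₀, f₀]; fun_prop) (by simpa [g₀, f₀] using hC) he
  have w3 := eventually_pos_of_tendsto (F := fun δ E => g₀ τ v δ E + f₀ τ v δ E)
    (by simp only [g₀, f₀]; fun_prop) (by simpa [g₀, f₀] using hC) he
  have w4 := eventually_pos_of_tendsto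
    (F := fun δ E => g₀ τ v δ E - f₀ τ v δ E + (g₁ τ v - f₁ τ v) * E)
    (by simp only [g₀, f₀]; fun_prop) (by simpa [g₀, f₀] using hC) he
  have w5 := eventually_pos_of_tendsto
    (F := fun δ E => g₀ τ v δ E + f₀ τ v δ E + (g₁ τ v + f₁ τ v) * E)
    (by simp only [g₀, f₀]; fun_prop) (by simpa [g₀, f₀] using hC) he
  filter_upwards [hev, w1, w2, w3, w4, w5] with δ h h1 h2 h3 h4 h5
  exact ⟨⟨h.1, h.2.1, h1, h2, h3, h4, h5⟩, h.2.2.1⟩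

/-- At order one the bifurcation equations are linear, and their roots explicit. -/
theorem root₁_order_one {ε δ : ℝ} (hC : 0 < v.C) (hs : 0 < 2 * v.B + 4 * ε * v.C) (hδ : δ < 0) :
    Root₁ ε 0 v δ (-δ / (2 * v.B + 4 * ε * v.C)) := by
  refine ⟨div_pos (neg_pos.2 hδ) hs, ?_, ?_, ?_, ?_⟩ <;> simp only [p₁, κ₁, f₀, f₁, g₀, g₁]
  · field_simp; ring
  all_goals linarith

theorem root₂_order_one {ε δ : ℝ} (hC : 0 < v.C) (hs : 0 < 2 * v.B - 4 * ε * v.C) (hδ : δ < 0) :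
    Root₂ ε 0 v δ (-δ / (2 * v.B - 4 * ε * v.C)) := by
  refine ⟨div_pos (neg_pos.2 hδ) hs, ?_, ?_, ?_, ?_⟩ <;> simp only [p₂, κ₂, f₀, f₁, g₀, g₁]
  · field_simp; ring
  all_goals linarith

theorem gapRoot_order_one {δ : ℝ} (hC : 0 < v.C) (hB : 0 < v.B) (hδ : δ < 0) :
    GapRoot 0 v δ (-δ / (2 * v.B)) := by
  refine ⟨div_pos (neg_pos.2 hδ) (by positivity), ?_, by linarith, ?_, ?_, ?_, ?_⟩
  · field_simp; ring
  all_goals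
    simp only [f₀, f₁, g₀, g₁, zero_mul, add_zero, sub_zero]
    linarith

/-! ### The bifurcation curves -/

theorem E1I₁_eq (hA : v.A = 2 * v.C) (δ : ℝ) :
    E1I₁ v δ = -δ / (2 * v.B + 4 * 1 * v.C) := by
  rw [E1I₁, hA, show 2 * (2 * (2 * v.C) - v.B - 6 * v.C) = -(2 * v.B + 4 * 1 * v.C) by ring,
    div_neg, neg_div]

theorem E1L₁_eq (hA : v.A = 2 * v.C) (δ : ℝ) :
    E1L₁ v δ = -δ / (2 * v.B + 4 * (-1) * v.C) := by
  rw [E1L₁, hA, show 2 * (2 * (2 * v.C) - v.B - 2 * v.C) = -(2 * v.B + 4 * (-1) * v.C) by ring,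
    div_neg, neg_div]

theorem E2I₁_eq (hA : v.A = 2 * v.C) (δ : ℝ) :
    E2I₁ v δ = -δ / (2 * v.B - 4 * 1 * v.C) := by
  rw [E2I₁, hA, show 2 * (2 * (2 * v.C) + v.B - 6 * v.C) = 2 * v.B - 4 * 1 * v.C by ring]

theorem E2L₁_eq (hA : v.A = 2 * v.C) (δ : ℝ) :
    E2L₁ v δ = -δ / (2 * v.B - 4 * (-1) * v.C) := by
  rw [E2L₁, hA, show 2 * (2 * (2 * v.C) + v.B - 2 * v.C) = 2 * v.B - 4 * (-1) * v.C by ring]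

theorem E1I₂_eq (hA : v.A = 2 * v.C) (hs : 0 < 2 * v.B + 4 * 1 * v.C) (δ : ℝ) :
    E1I₂ v δ = -δ / (2 * v.B + 4 * 1 * v.C) + (p₁ 1 1 v / (2 * v.B + 4 * 1 * v.C) ^ 2
        - κ₁ 1 1 v / (2 * v.B + 4 * 1 * v.C) ^ 3) * δ ^ 2 := by
  rw [E1I₂, E1I₁_eq hA, hA,
    show 2 * (2 * v.C) - v.B - 6 * v.C = -((2 * v.B + 4 * 1 * v.C) / 2) by ring]
  simp only [p₁, κ₁, Coeffs.m03, Coeffs.m12, Coeffs.n2]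
  rw [v22_eq, v04_eq hA]
  have := hs.ne'
  field_simp
  ring

theorem E1L₂_eq (hA : v.A = 2 * v.C) (hs : 0 < 2 * v.B + 4 * (-1) * v.C) (δ : ℝ) :
    E1L₂ v δ = -δ / (2 * v.B + 4 * (-1) * v.C) + (p₁ (-1) 1 v / (2 * v.B + 4 * (-1) * v.C) ^ 2
        - κ₁ (-1) 1 v / (2 * v.B + 4 * (-1) * v.C) ^ 3) * δ ^ 2 := by
  rw [E1L₂, E1L₁_eq hA, hA,
    show 2 * (2 * v.C) - v.B - 2 * v.C = -((2 * v.B + 4 * (-1) * v.C) / 2) by ring]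
  simp only [p₁, κ₁, Coeffs.m03, Coeffs.m12, Coeffs.n2]
  rw [v22_eq, v04_eq hA]
  have := hs.ne'
  field_simp
  ring

theorem E2I₂_eq (hA : v.A = 2 * v.C) (hs : 0 < 2 * v.B - 4 * 1 * v.C) (δ : ℝ) :
    E2I₂ v δ = -δ / (2 * v.B - 4 * 1 * v.C) + (p₂ 1 1 v / (2 * v.B - 4 * 1 * v.C) ^ 2
        - κ₂ 1 1 v / (2 * v.B - 4 * 1 * v.C) ^ 3) * δ ^ 2 := by
  rw [E2I₂, E2I₁_eq hA, hA,
    show 2 * (2 * v.C) + v.B - 6 * v.C = (2 * v.B - 4 * 1 * v.C) / 2 by ring]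
  simp only [p₂, κ₂, Coeffs.m30, Coeffs.m21, Coeffs.n1]
  rw [v22_eq, v40_eq hA]
  have := hs.ne'
  field_simp
  ring

theorem E2L₂_eq (hA : v.A = 2 * v.C) (hs : 0 < 2 * v.B - 4 * (-1) * v.C) (δ : ℝ) :
    E2L₂ v δ = -δ / (2 * v.B - 4 * (-1) * v.C) + (p₂ (-1) 1 v / (2 * v.B - 4 * (-1) * v.C) ^ 2
        - κ₂ (-1) 1 v / (2 * v.B - 4 * (-1) * v.C) ^ 3) * δ ^ 2 := by
  rw [E2L₂, E2L₁_eq hA, hA,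
    show 2 * (2 * v.C) + v.B - 2 * v.C = (2 * v.B - 4 * (-1) * v.C) / 2 by ring]
  simp only [p₂, κ₂, Coeffs.m30, Coeffs.m21, Coeffs.n1]
  rw [v22_eq, v40_eq hA]
  have := hs.ne'
  field_simp
  ring

theorem exists_Ioo_of_eventually {p : ℝ → Prop} (h : ∀ᶠ δ in 𝓝[<] (0 : ℝ), p δ) :
    ∃ δ₀ > 0, ∀ δ ∈ Ioo (-δ₀) 0, p δ := by
  obtain ⟨l, hl, hsub⟩ := mem_nhdsLT_iff_exists_Ioo_subset.1 h
  exact ⟨-l, neg_pos.2 hl, fun δ hδ => hsub (by rwa [neg_neg] at hδ)⟩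

/-- Two roots with the same first order term differ by `O(δ²)`. -/
theorem abs_sub_le_of_first_order {x y z M N d : ℝ} (hx : |x - z| ≤ M * d) (hy : |y - z| ≤ N * d) :
    |x - y| ≤ (M + N) * d := by
  have := abs_sub_le x z y
  rw [abs_sub_comm z y] at this
  linarith

end Degenerate

end Resonance22

theorem proposition8 (v : Coeffs) (hA : v.A = 2 * v.C) (hC : 0 < v.C) :
    -- the system truncated at order `N = 1`: exact coincidence
    ((-2 * v.C < v.B → ∀ δ < 0, E1I₁ v δ = E2L₁ v δ ∧
        Pitchfork1I (normalForm₁ v δ) (E1I₁ v δ) ∧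
        Pitchfork2L (normalForm₁ v δ) (E2L₁ v δ)) ∧
      (0 < v.B → ∀ δ < 0, GlobalBifurcationAt (normalForm₁ v δ) (EGB₁ v δ)) ∧
      (2 * v.C < v.B → ∀ δ < 0, E1L₁ v δ = E2I₁ v δ ∧
        AntiPitchfork1L (normalForm₁ v δ) (E1L₁ v δ) ∧
        AntiPitchfork2I (normalForm₁ v δ) (E2I₁ v δ))) ∧
    -- the system truncated at order `N = 2`: coincidence at first order in the detuning
    ((-2 * v.C < v.B → ∃ δ₀ > 0, ∃ M > 0, ∃ e1I e2L : ℝ → ℝ, ∀ δ ∈ Set.Ioo (-δ₀) 0,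
        Pitchfork1I (normalForm₂ v δ) (e1I δ) ∧ Pitchfork2L (normalForm₂ v δ) (e2L δ) ∧
        |e1I δ - E1I₂ v δ| ≤ M * |δ| ^ 3 ∧ |e2L δ - E2L₂ v δ| ≤ M * |δ| ^ 3 ∧
        |e1I δ - e2L δ| ≤ M * δ ^ 2) ∧
      (0 < v.B → ∃ δ₀ > 0, ∃ M > 0, ∃ eGB : ℝ → ℝ, ∀ δ ∈ Set.Ioo (-δ₀) 0,
        GlobalBifurcationAt (normalForm₂ v δ) (eGB δ) ∧ |eGB δ - EGB₁ v δ| ≤ M * δ ^ 2) ∧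
      (2 * v.C < v.B → ∃ δ₀ > 0, ∃ M > 0, ∃ e1L e2I : ℝ → ℝ, ∀ δ ∈ Set.Ioo (-δ₀) 0,
        AntiPitchfork1L (normalForm₂ v δ) (e1L δ) ∧ AntiPitchfork2I (normalForm₂ v δ) (e2I δ) ∧
        |e1L δ - E1L₂ v δ| ≤ M * |δ| ^ 3 ∧ |e2I δ - E2I₂ v δ| ≤ M * |δ| ^ 3 ∧
        |e1L δ - e2I δ| ≤ M * δ ^ 2)) := by
  refine ⟨⟨fun hB δ hδ => ?_, fun hB δ hδ => ?_, fun hB δ hδ => ?_⟩,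
    fun hB => ?_, fun hB => ?_, fun hB => ?_⟩
  · rw [← nf_zero, E1I₁_eq hA, E2L₁_eq hA]
    exact ⟨by ring_nf, (root₁_order_one hC (by linarith) hδ).pitchfork hA,
      (root₂_order_one hC (by linarith) hδ).pitchfork hA⟩
  · rw [← nf_zero]
    exact (gapRoot_order_one hC hB hδ).globalBifurcation hA
  · rw [← nf_zero, E1L₁_eq hA, E2I₁_eq hA]
    exact ⟨by ring_nf, (root₁_order_one hC (by linarith) hδ).antiPitchfork hA,
      (root₂_order_one hC (by linarith) hδ).antiPitchfork hA⟩
  · have hs₁ : 0 < 2 * v.B + 4 * 1 * v.C := by linarith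
    have hs₂ : 0 < 2 * v.B - 4 * (-1) * v.C := by linarith
    obtain ⟨e₁, M₁, hM₁, hev₁⟩ := exists_root₁ (τ := 1) hC hs₁
    obtain ⟨e₂, M₂, hM₂, hev₂⟩ := exists_root₂ (τ := 1) hC hs₂
    obtain ⟨δ₀, hδ₀, h⟩ := exists_Ioo_of_eventually (hev₁.and hev₂)
    refine ⟨δ₀, hδ₀, M₁ + M₂, by positivity, e₁, e₂, fun δ hδ => ?_⟩
    obtain ⟨⟨r₁, a₁, b₁⟩, r₂, a₂, b₂⟩ := h δ hδ
    have h3 : 0 ≤ |δ| ^ 3 := by positivity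
    rw [← nf_one, E1I₂_eq hA hs₁, E2L₂_eq hA hs₂]
    rw [show 2 * v.B - 4 * (-1) * v.C = 2 * v.B + 4 * 1 * v.C by ring] at a₂
    exact ⟨r₁.pitchfork hA, r₂.pitchfork hA, b₁.trans (by nlinarith), b₂.trans (by nlinarith),
      abs_sub_le_of_first_order a₁ a₂⟩
  · obtain ⟨e, M, hM, hev⟩ := exists_gapRoot (τ := 1) hC hB
    obtain ⟨δ₀, hδ₀, h⟩ := exists_Ioo_of_eventually hev
    refine ⟨δ₀, hδ₀, M, hM, e, fun δ hδ => ?_⟩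
    rw [← nf_one]
    exact ⟨(h δ hδ).1.globalBifurcation hA, (h δ hδ).2⟩
  · have hs₁ : 0 < 2 * v.B + 4 * (-1) * v.C := by linarith
    have hs₂ : 0 < 2 * v.B - 4 * 1 * v.C := by linarith
    obtain ⟨e₁, M₁, hM₁, hev₁⟩ := exists_root₁ (τ := 1) hC hs₁
    obtain ⟨e₂, M₂, hM₂, hev₂⟩ := exists_root₂ (τ := 1) hC hs₂
    obtain ⟨δ₀, hδ₀, h⟩ := exists_Ioo_of_eventually (hev₁.and hev₂)
    refine ⟨δ₀, hδ₀, M₁ + M₂, by positivity, e₁, e₂, fun δ hδ => ?_⟩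
    obtain ⟨⟨r₁, a₁, b₁⟩, r₂, a₂, b₂⟩ := h δ hδ
    have h3 : 0 ≤ |δ| ^ 3 := by positivity
    rw [← nf_one, E1L₂_eq hA hs₁, E2I₂_eq hA hs₂]
    rw [show 2 * v.B - 4 * 1 * v.C = 2 * v.B + 4 * (-1) * v.C by ring] at a₂
    exact ⟨r₁.antiPitchfork hA, r₂.antiPitchfork hA, b₁.trans (by nlinarith),
      b₂.trans (by nlinarith), abs_sub_le_of_first_order a₁ a₂⟩
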